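/- Let $\ell,s_1,s_2,v,v_b>0$ with $s_1\neq s_2$, put $L=2\ell+s_1+s_2$, let $D=(0,\ell)\cup(\ell+s_1,2\ell+s_1)$ be the union of the two resonators (of equal length) in a unit cell, and let $\mathcal C=\bigcup_{n\in\mathbb Z}(D+nL)$ be the whole periodic chain. For a contrast $\delta>0$, a quasiperiodicity $\alpha\in\mathbb R$ and a frequency $\omega\ge 0$, a *mode* is a continuous function $\psi:\mathbb R\to\mathbb C$ with $\psi(x+L)=e^{i\alpha L}\psi(x)$ such that $\psi''+\frac{\omega^2}{v_b^2}\psi=0$ in $\mathcal C$, $\psi''+\frac{\omega^2}{v^2}\psi=0$ in $\mathbb R\setminus\overline{\mathcal C}$, and, at every end point of a resonator, the one-sided derivative of $\psi$ from inside the resonator equals $\delta$ times the one-sided derivative from outside. If a nonzero mode exists, $\omega$ is called a *resonance* for $(\delta,\alpha)$. A *subwavelength band* is a family $\omega^\alpha(\delta)$ which, for all sufficiently small $\delta>0$, is continuous and $\frac{2\pi}{L}$-periodic in $\alpha$ and consists of resonances for $(\delta,\alpha)$, and which satisfies $\omega^\alpha(\delta)\to0$ as $\delta\to0$ for every $\alpha$.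 Then there are exactly two subwavelength bands: there exist subwavelength bands $\omega_1,\omega_2$ with $\omega_1^\alpha(\delta)<\omega_2^\alpha(\delta)$ for all $\alpha$ if $\delta>0$ is small enough, and every subwavelength band $\omega$ satisfies, for each sufficiently small $\delta>0$, either $\omega^\alpha(\delta)=\omega_1^\alpha(\delta)$ for all $\alpha$ or $\omega^\alpha(\delta)=\omega_2^\alpha(\delta)$ for all $\alpha$. Moreover, let $\omega$ be any subwavelength band. Then for all sufficiently small $\delta>0$ the band is non-degenerate (for every $\alpha$ the space of modes of frequency $\omega^\alpha(\delta)$ is one-dimensional), and its Zak phase $$\varphi(u)=i\int_{-\pi/L}^{\pi/L}\Big\langle u^\alpha,\frac{\partial}{\partial\alpha}u^\alpha\Big\rangle_{L^2(D)}\,d\alpha$$ is, modulo $2\pi$, equal to $\pi$ if $s_1>s_2$ and to $0$ if $s_1<s_2$. Precisely: for every family $(u^\alpha)_{\alpha\in\mathbb R}$ in $L^2(D)$ such that $u^\alpha$ is the restriction to $D$ of a mode of frequency $\omega^\alpha(\delta)$ and quasiperiodicity $\alpha$, $\|u^\alpha\|_{L^2(D)}=1$, $\alpha\mapsto u^\alpha\in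 L^2(D)$ is continuous, $\frac{2\pi}{L}$-periodic and differentiable outside a countable set, and $\alpha\mapsto\langle u^\alpha,\partial_\alpha u^\alpha\rangle_{L^2(D)}$ is integrable on $[-\frac\pi L,\frac\pi L]$, one has $\varphi(u)\in\pi+2\pi\mathbb Z$ if $s_1>s_2$ and $\varphi(u)\in2\pi\mathbb Z$ if $s_1<s_2$; and there is such a family with $\varphi(u)=\pi$ exactly if $s_1>s_2$, and with $\varphi(u)=0$ exactly if $s_1<s_2$. -/

import Mathlib

open Filter Topology MeasureTheory

/-- A Hermitian dimer chain of resonators on the real line: two resonators of lengths `ℓ₁`, `ℓ₂`,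
separated by a gap of length `s₁` and followed by a gap of length `s₂`, repeated periodically.
`v` is the wave speed in the background and `vb` the (real, common) wave speed in the
resonators. -/
structure DimerChain where
  ℓ₁ : ℝ
  ℓ₂ : ℝ
  s₁ : ℝ
  s₂ : ℝ
  v : ℝ
  vb : ℝ
  ℓ₁_pos : 0 < ℓ₁
  ℓ₂_pos : 0 < ℓ₂
  s₁_pos : 0 < s₁
  s₂_pos : 0 < s₂
  v_pos : 0 < v
  vb_pos : 0 < vb

namespace DimerChain

/-- The length of the unit cell. -/
def L (c : DimerChain) : ℝ := c.ℓ₁ + c.s₁ + c.ℓ₂ + c.s₂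

/-- The two resonators in the unit cell `(0, L)`. -/
def D (c : DimerChain) : Set ℝ :=
  Set.Ioo 0 c.ℓ₁ ∪ Set.Ioo (c.ℓ₁ + c.s₁) (c.ℓ₁ + c.s₁ + c.ℓ₂)

/-- The two gaps in the unit cell `(0, L)`. -/
def G (c : DimerChain) : Set ℝ :=
  Set.Ioo c.ℓ₁ (c.ℓ₁ + c.s₁) ∪ Set.Ioo (c.ℓ₁ + c.s₁ + c.ℓ₂) c.L

/-- The whole (open) system of resonators. -/
def crystal (c : DimerChain) : Set ℝ := {x | ∃ n : ℤ, x - n * c.L ∈ c.D}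

/-- The whole (open) background medium; what is left of the line is the set of end points of the
resonators. -/
def background (c : DimerChain) : Set ℝ := {x | ∃ n : ℤ, x - n * c.L ∈ c.G}

/-- `ψ` is an `α`-quasiperiodic solution of the coupled Helmholtz equations with frequency `ω` and
contrast `δ`: `ψ'' + (ω / vb)² ψ = 0` in the resonators, `ψ'' + (ω / v)² ψ = 0` in the background,
`ψ` is continuous, and at the end points of the resonators the derivative from inside equals `δ`
times the derivative from outside. The last condition says that the flux `q`, equal to `ψ'` in the
resonators and to `δ ψ'` in the background, is continuous on the line. -/
def IsMode (c : DimerChain) (δ α ω : ℝ) (ψ : ℝ → ℂ) : Prop :=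
  Continuous ψ ∧
  (∀ x, ψ (x + c.L) = Complex.exp (Complex.I * α * c.L) * ψ x) ∧
  ∃ q : ℝ → ℂ, Continuous q ∧
    (∀ x ∈ c.crystal, HasDerivAt ψ (q x) x ∧ HasDerivAt q (-((ω / c.vb) ^ 2 : ℝ) * ψ x) x) ∧
    (∀ x ∈ c.background,
      HasDerivAt ψ (q x / δ) x ∧ HasDerivAt q (-(δ * (ω / c.v) ^ 2 : ℝ) * ψ x) x)

/-- The (nonnegative) resonances at quasiperiodicity `α` and contrast `δ`. -/
def resonances (c : DimerChain) (δ α : ℝ) : Set ℝ :=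
  {ω | 0 ≤ ω ∧ ∃ ψ : ℝ → ℂ, ψ ≠ 0 ∧ c.IsMode δ α ω ψ}

/-- `ω δ α` is a subwavelength band: for small `δ > 0` it is a continuous function of `α` in the
Brillouin zone `ℝ / (2π/L)ℤ` whose values are resonances, and these tend to `0` as `δ → 0`. -/
def IsSubwavelengthBand (c : DimerChain) (ω : ℝ → ℝ → ℝ) : Prop :=
  (∀ᶠ δ in 𝓝[>] (0 : ℝ), Continuous (ω δ) ∧ Function.Periodic (ω δ) (2 * Real.pi / c.L) ∧
    ∀ α, ω δ α ∈ c.resonances δ α) ∧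
  ∀ α, Tendsto (fun δ => ω δ α) (𝓝[>] 0) (𝓝 0)

/-- The band `ω` (at contrast `δ`) is non-degenerate: for every `α` the space of modes of frequency
`ω α` has dimension at most one. -/
def IsNondegenerate (c : DimerChain) (δ : ℝ) (ω : ℝ → ℝ) : Prop :=
  ∀ α (ψ φ : ℝ → ℂ), c.IsMode δ α (ω α) ψ → c.IsMode δ α (ω α) φ → ψ ≠ 0 → ∃ a : ℂ, φ = a • ψ

/-- `u` is a family of normalised eigenmodes of the band `ω`, seen in `L²(D)`, which depends
continuously on `α` in the Brillouin zone `ℝ / (2π/L)ℤ`, and for which the integral in the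
definition of the Zak phase makes sense. -/
structure IsModeFamily (c : DimerChain) (δ : ℝ) (ω : ℝ → ℝ)
    (u : ℝ → Lp ℂ 2 (volume.restrict c.D)) : Prop where
  mode : ∀ α, ∃ ψ : ℝ → ℂ, c.IsMode δ α (ω α) ψ ∧ u α =ᵐ[volume.restrict c.D] ψ
  normalised : ∀ α, ‖u α‖ = 1
  continuous : Continuous u
  periodic : Function.Periodic u (2 * Real.pi / c.L)
  differentiable : ∃ S : Set ℝ, S.Countable ∧ ∀ α ∉ S, DifferentiableAt ℝ u α
  integrable : IntervalIntegrable (fun α => inner ℂ (u α) (deriv u α)) volume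
    (-(Real.pi / c.L)) (Real.pi / c.L)

/-- The Zak phase of a family of modes. -/
noncomputable def zak (c : DimerChain) (u : ℝ → Lp ℂ 2 (volume.restrict c.D)) : ℂ :=
  Complex.I * ∫ α in (-(Real.pi / c.L))..(Real.pi / c.L), inner ℂ (u α) (deriv u α)

end DimerChain

/-! Because the resonators have equal length, the chain is symmetric about the centre of the first
gap. Let `T = (a b; g d)` carry the state `(ψ, q)` from there to the centre of the second gap; its
entries are `tA`, `tB`, `tC`, `tD`, and `det T = 1`. Reflection gives the state in the preceding
second gap from `(y, -z)`, so with `θ = αL/2` quasiperiodicity becomes `b cos θ z = i sin θ a y` and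
`g cos θ y = i sin θ d z` (`closes_iff`). By `det T = 1` this has a nonzero solution exactly when `a
d = cos² θ`.

At low frequency `a` and `d` decrease strictly from `1`, and for small `δ` the impedance ratio,
which grows like `1/δ`, pushes both below `-1` inside any prescribed window `[0, ε]`
(`exists_window`). Hence `a d = cos² θ` has one root with `a, d ≥ 0` and one with `a, d ≤ 0`: the
two bands. Since `a - d` has the sign of `s₁ - s₂` for `ω > 0`, the two entries never vanish
together. This separates the bands, makes modes unique up to a factor, and by connectedness forces a
continuous family of low resonances to stay on one band.

For the Zak phase take `y = A`, `z = i B` with `A`, `B` real. The mode is then conjugated by the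
reflection on `D`, so such modes have real inner products and a normalised frame `w` of them
satisfies `⟨w, w'⟩ = 0`. Any admissible family is `f w` with `|f| = 1`, and its Zak phase is minus
the change of the argument of `f`: an even multiple of `π` if `w` is periodic, an odd one if `w` is
antiperiodic (`RealFrame.phase`). Finally `zak_of_onBand` writes down nowhere vanishing `(A, B)`.
For `s₁ > s₂` they are linear in `(cos θ, sin θ)`, which changes sign over the Brillouin zone; for
`s₁ < s₂` only the invariant product `sin θ cos θ` enters. -/

namespace DimerChain

/-! ### Propagation of `(ψ, q)` in a homogeneous medium -/

/-- The solution `sin (κ y) / κ` of `f'' + κ² f = 0` (equal to `y` if `κ = 0`). -/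
noncomputable def sn (κ y : ℝ) : ℝ := y * Real.sinc (κ * y)

theorem mul_sn (κ y : ℝ) : κ * sn κ y = Real.sin (κ * y) := by
  unfold sn
  by_cases h : κ * y = 0
  · rcases mul_eq_zero.1 h with h | h <;> simp [h]
  · rw [Real.sinc_of_ne_zero h]
    have h1 : κ ≠ 0 := left_ne_zero_of_mul h
    have h2 : y ≠ 0 := right_ne_zero_of_mul h
    field_simp

theorem sn_of_ne_zero {κ : ℝ} (h : κ ≠ 0) (y : ℝ) : sn κ y = Real.sin (κ * y) / κ := by
  rw [← mul_sn]; field_simp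

@[simp] theorem sn_zero_left (y : ℝ) : sn 0 y = y := by simp [sn]

@[simp] theorem sn_zero_right (κ : ℝ) : sn κ 0 = 0 := by simp [sn]

@[simp] theorem sn_neg (κ y : ℝ) : sn κ (-y) = -sn κ y := by simp [sn]

theorem sn_add (κ x y : ℝ) :
    sn κ (x + y) = sn κ x * Real.cos (κ * y) + Real.cos (κ * x) * sn κ y := by
  by_cases h : κ = 0
  · simp [h]
  · simp only [sn_of_ne_zero h, mul_add, Real.sin_add]
    field_simp

@[fun_prop]
theorem continuous_sn {X : Type*} [TopologicalSpace X] {f g : X → ℝ} (hf : Continuous f)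
    (hg : Continuous g) : Continuous fun x => sn (f x) (g x) := by
  unfold sn
  exact hg.mul (Real.continuous_sinc.comp (hf.mul hg))

theorem hasDerivAt_sn (κ y : ℝ) : HasDerivAt (sn κ) (Real.cos (κ * y)) y := by
  by_cases h : κ = 0
  · subst h
    have : sn 0 = fun y => y := by ext; simp
    rw [this]
    simpa using hasDerivAt_id' y
  · have : sn κ = fun y => Real.sin (κ * y) / κ := by ext; simp [sn_of_ne_zero h]
    rw [this]
    have := (((hasDerivAt_id y).const_mul κ).sin).div_const κ
    refine this.congr_deriv ?_
    simp only [id]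
    field_simp

theorem cos_sq_add_sn_sq (κ y : ℝ) : Real.cos (κ * y) ^ 2 + κ ^ 2 * sn κ y ^ 2 = 1 := by
  rw [← mul_pow, mul_sn, Real.cos_sq_add_sin_sq]

/-- The solution of `ψ' = q / ρ`, `q' = -ρ κ² ψ` with initial values `ψ = p`, `q = r`: value
of `ψ`. -/
noncomputable def wave (κ ρ : ℝ) (p r : ℂ) (y : ℝ) : ℂ :=
  p * (Real.cos (κ * y) : ℝ) + r / ρ * (sn κ y : ℝ)

/-- The solution of `ψ' = q / ρ`, `q' = -ρ κ² ψ` with initial values `ψ = p`, `q = r`: value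
of `q`. -/
noncomputable def flux (κ ρ : ℝ) (p r : ℂ) (y : ℝ) : ℂ :=
  r * (Real.cos (κ * y) : ℝ) - ρ * κ ^ 2 * p * (sn κ y : ℝ)

section
variable (κ ρ : ℝ) (p r : ℂ) (x y : ℝ)

@[simp] theorem wave_zero : wave κ ρ p r 0 = p := by simp [wave]

@[simp] theorem flux_zero : flux κ ρ p r 0 = r := by simp [flux]

theorem wave_neg : wave κ ρ p r (-y) = wave κ ρ p (-r) y := by
  simp [wave]; ring

theorem flux_neg : flux κ ρ p r (-y) = -flux κ ρ p (-r) y := by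
  simp [flux]; ring

theorem wave_smul (a : ℂ) : wave κ ρ (a * p) (a * r) y = a * wave κ ρ p r y := by
  simp [wave]; ring

theorem flux_smul (a : ℂ) : flux κ ρ (a * p) (a * r) y = a * flux κ ρ p r y := by
  simp [flux]; ring

@[fun_prop] theorem continuous_wave : Continuous (wave κ ρ p r) := by unfold wave; fun_prop

@[fun_prop] theorem continuous_flux : Continuous (flux κ ρ p r) := by unfold flux; fun_prop

theorem hasDerivAt_cos_mul : HasDerivAt (fun y => ((Real.cos (κ * y) : ℝ) : ℂ))
    (-(κ ^ 2 * sn κ y : ℝ) : ℂ) y := by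
  have h := (((hasDerivAt_id y).const_mul κ).cos).ofReal_comp
  refine h.congr_deriv ?_
  simp only [id, ← mul_sn]
  push_cast; ring

variable {ρ}

theorem hasDerivAt_wave (hρ : ρ ≠ 0) :
    HasDerivAt (wave κ ρ p r) (flux κ ρ p r y / ρ) y := by
  have h1 := (hasDerivAt_cos_mul κ y).const_mul p
  have h2 := (hasDerivAt_sn κ y).ofReal_comp.const_mul (r / ρ)
  refine (h1.add h2).congr_deriv ?_
  have : (ρ : ℂ) ≠ 0 := by exact_mod_cast hρ
  simp only [flux]; push_cast; field_simp; ring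

theorem hasDerivAt_flux (hρ : ρ ≠ 0) :
    HasDerivAt (flux κ ρ p r) (-(ρ * κ ^ 2 : ℝ) * wave κ ρ p r y) y := by
  have h1 := (hasDerivAt_cos_mul κ y).const_mul r
  have h2 := (hasDerivAt_sn κ y).ofReal_comp.const_mul (ρ * κ ^ 2 * p)
  refine (h1.sub h2).congr_deriv ?_
  have : (ρ : ℂ) ≠ 0 := by exact_mod_cast hρ
  simp only [wave]; push_cast; field_simp; ring

theorem wave_add (hρ : ρ ≠ 0) :
    wave κ ρ p r (x + y) = wave κ ρ (wave κ ρ p r x) (flux κ ρ p r x) y := by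
  have : (ρ : ℂ) ≠ 0 := by exact_mod_cast hρ
  simp only [wave, flux, sn_add, mul_add, Real.cos_add, ← mul_sn]
  push_cast; field_simp; ring

theorem flux_add (hρ : ρ ≠ 0) :
    flux κ ρ p r (x + y) = flux κ ρ (wave κ ρ p r x) (flux κ ρ p r x) y := by
  have : (ρ : ℂ) ≠ 0 := by exact_mod_cast hρ
  simp only [wave, flux, sn_add, mul_add, Real.cos_add, ← mul_sn]
  push_cast; field_simp; ring

-- On an open interval the derivative vanishes too, so the whole state is zero at one point and can
-- be propagated back to the origin.
variable {p r} in
theorem eq_zero_of_wave_eq_zero (hρ : ρ ≠ 0) {u v : ℝ} (huv : u < v)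
    (h : ∀ y ∈ Set.Ioo u v, wave κ ρ p r y = 0) : p = 0 ∧ r = 0 := by
  obtain ⟨y, hy⟩ := Set.nonempty_Ioo.2 huv
  have h0 := h y hy
  have h1 : flux κ ρ p r y = 0 := by
    have e : wave κ ρ p r =ᶠ[𝓝 y] fun _ => 0 :=
      Filter.eventually_of_mem (isOpen_Ioo.mem_nhds hy) h
    have := (hasDerivAt_wave κ p r y hρ).unique ((hasDerivAt_const y (0 : ℂ)).congr_of_eventuallyEq e)
    simpa [hρ] using this
  constructor
  · have := wave_add κ p r y (-y) hρ
    rw [h0, h1] at this; simpa [wave] using this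
  · have := flux_add κ p r y (-y) hρ
    rw [h0, h1] at this; simpa [flux] using this

end

theorem eq_of_hasDerivAt_zero {f : ℝ → ℂ} {x₀ x₁ : ℝ} (hf : Continuous f)
    (h : ∀ x ∈ Set.Ioo x₀ x₁, HasDerivAt f 0 x) {s t : ℝ} (hs : s ∈ Set.Icc x₀ x₁)
    (ht : t ∈ Set.Icc x₀ x₁) : f s = f t := by
  wlog hst : s ≤ t generalizing s t
  · exact (this ht hs (le_of_not_ge hst)).symm
  have := intervalIntegral.integral_eq_sub_of_hasDerivAt_of_le (f := f) (f' := fun _ => 0) hst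
    hf.continuousOn (fun x hx => h x ⟨hs.1.trans_lt hx.1, hx.2.trans_le ht.2⟩) (by simp)
  simp only [intervalIntegral.integral_zero] at this
  exact (sub_eq_zero.1 this.symm).symm

/-- Solutions on an interval are determined by their values at one point. -/
theorem eq_wave {κ ρ x₀ x₁ : ℝ} (hρ : ρ ≠ 0) {ψ q : ℝ → ℂ} (hψ : Continuous ψ)
    (hq : Continuous q) (h : ∀ x ∈ Set.Ioo x₀ x₁,
      HasDerivAt ψ (q x / ρ) x ∧ HasDerivAt q (-(ρ * κ ^ 2 : ℝ) * ψ x) x)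
    {s t : ℝ} (hs : s ∈ Set.Icc x₀ x₁) (ht : t ∈ Set.Icc x₀ x₁) :
    ψ t = wave κ ρ (ψ s) (q s) (t - s) ∧ q t = flux κ ρ (ψ s) (q s) (t - s) := by
  have hρ' : (ρ : ℂ) ≠ 0 := by exact_mod_cast hρ
  have hc (x : ℝ) : HasDerivAt (fun x => ((Real.cos (κ * (t - x)) : ℝ) : ℂ))
      ((κ ^ 2 * sn κ (t - x) : ℝ) : ℂ) x := by
    have := (hasDerivAt_cos_mul κ (t - x)).scomp x ((hasDerivAt_id x).const_sub t)
    refine this.congr_deriv ?_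
    simp
  have hs' (x : ℝ) : HasDerivAt (fun x => ((sn κ (t - x) : ℝ) : ℂ))
      (-(Real.cos (κ * (t - x)) : ℝ) : ℂ) x := by
    have := ((hasDerivAt_sn κ (t - x)).ofReal_comp).scomp x ((hasDerivAt_id x).const_sub t)
    refine this.congr_deriv ?_
    simp
  constructor
  -- Propagating the state at `x` to the fixed point `t` gives a function of `x` with zero
  -- derivative; compare its values at `s` and `t`.
  · have := eq_of_hasDerivAt_zero (f := fun x => wave κ ρ (ψ x) (q x) (t - x)) (x₀ := x₀)
      (x₁ := x₁) (by unfold wave; fun_prop) (fun x hx => ?_) hs ht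
    · simpa using this.symm
    · unfold wave
      obtain ⟨h1, h2⟩ := h x hx
      refine ((h1.mul (hc x)).add ((h2.div_const _).mul (hs' x))).congr_deriv ?_
      push_cast; field_simp; ring
  · have := eq_of_hasDerivAt_zero (f := fun x => flux κ ρ (ψ x) (q x) (t - x)) (x₀ := x₀)
      (x₁ := x₁) (by unfold flux; fun_prop) (fun x hx => ?_) hs ht
    · simpa using this.symm
    · unfold flux
      obtain ⟨h1, h2⟩ := h x hx
      refine ((h2.mul (hc x)).sub ((h1.const_mul _).mul (hs' x))).congr_deriv ?_
      push_cast; field_simp; ring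

end DimerChain
-- Solutions on the unit cell and their quasiperiodic extension
namespace DimerChain

variable (c : DimerChain) (δ ω : ℝ) (y z : ℂ)

/-! The centre of the first gap is a centre of symmetry of the chain. A solution with values
`(y, z)` of `(ψ, q)` at this centre is followed to the second resonator, to its far end, and to the
centre of the second gap. -/

noncomputable def resP : ℂ := wave (ω / c.v) δ y z (c.s₁ / 2)
noncomputable def resR : ℂ := flux (ω / c.v) δ y z (c.s₁ / 2)
noncomputable def endP : ℂ := wave (ω / c.vb) 1 (c.resP δ ω y z) (c.resR δ ω y z) c.ℓ₁
noncomputable def endR : ℂ := flux (ω / c.vb) 1 (c.resP δ ω y z) (c.resR δ ω y z) c.ℓ₁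
noncomputable def farP : ℂ := wave (ω / c.v) δ (c.endP δ ω y z) (c.endR δ ω y z) (c.s₂ / 2)
noncomputable def farR : ℂ := flux (ω / c.v) δ (c.endP δ ω y z) (c.endR δ ω y z) (c.s₂ / 2)

/-- The solution in the unit cell with values `(y, z)` at the centre of the first gap. -/
noncomputable def cell (x : ℝ) : ℂ :=
  if x ≤ c.ℓ₁ then wave (ω / c.vb) 1 (c.resP δ ω y (-z)) (c.resR δ ω y (-z)) (c.ℓ₁ - x)
  else if x ≤ c.ℓ₁ + c.s₁ then wave (ω / c.v) δ y z (x - (c.ℓ₁ + c.s₁ / 2))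
  else if x ≤ c.ℓ₁ + c.s₁ + c.ℓ₁ then
    wave (ω / c.vb) 1 (c.resP δ ω y z) (c.resR δ ω y z) (x - (c.ℓ₁ + c.s₁))
  else wave (ω / c.v) δ (c.farP δ ω y z) (c.farR δ ω y z) (x - (c.ℓ₁ + c.s₁ + c.ℓ₁ + c.s₂ / 2))

/-- The flux of `cell`. -/
noncomputable def cellFlux (x : ℝ) : ℂ :=
  if x ≤ c.ℓ₁ then -flux (ω / c.vb) 1 (c.resP δ ω y (-z)) (c.resR δ ω y (-z)) (c.ℓ₁ - x)
  else if x ≤ c.ℓ₁ + c.s₁ then flux (ω / c.v) δ y z (x - (c.ℓ₁ + c.s₁ / 2))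
  else if x ≤ c.ℓ₁ + c.s₁ + c.ℓ₁ then
    flux (ω / c.vb) 1 (c.resP δ ω y z) (c.resR δ ω y z) (x - (c.ℓ₁ + c.s₁))
  else flux (ω / c.v) δ (c.farP δ ω y z) (c.farR δ ω y z) (x - (c.ℓ₁ + c.s₁ + c.ℓ₁ + c.s₂ / 2))

theorem resP_smul (a : ℂ) : c.resP δ ω (a * y) (a * z) = a * c.resP δ ω y z := wave_smul ..
theorem resR_smul (a : ℂ) : c.resR δ ω (a * y) (a * z) = a * c.resR δ ω y z := flux_smul ..

theorem farP_smul (a : ℂ) : c.farP δ ω (a * y) (a * z) = a * c.farP δ ω y z := by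
  simp only [farP, endP, endR, resP_smul, resR_smul, wave_smul, flux_smul]

theorem farR_smul (a : ℂ) : c.farR δ ω (a * y) (a * z) = a * c.farR δ ω y z := by
  simp only [farR, endP, endR, resP_smul, resR_smul, wave_smul, flux_smul]

theorem cell_smul (a : ℂ) (x : ℝ) : c.cell δ ω (a * y) (a * z) x = a * c.cell δ ω y z x := by
  unfold cell
  split_ifs
  · rw [← mul_neg, resP_smul, resR_smul, wave_smul]
  · rw [wave_smul]
  · rw [resP_smul, resR_smul, wave_smul]
  · rw [farP_smul, farR_smul, wave_smul]

/-- The solution with values `(y, z)` extends to an `e`-quasiperiodic one. -/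
def Closes (e y z : ℂ) : Prop :=
  c.farP δ ω y z = e * c.farP δ ω y (-z) ∧ c.farR δ ω y z = -(e * c.farR δ ω y (-z))

theorem L_pos : 0 < c.L := by
  have := c.ℓ₁_pos; have := c.ℓ₂_pos; have := c.s₁_pos; have := c.s₂_pos
  unfold L; positivity

theorem mem_crystal_of_mem_D {x : ℝ} (h : x ∈ c.D) : x ∈ c.crystal := ⟨0, by simpa using h⟩

theorem mem_background_of_mem_G {x : ℝ} (h : x ∈ c.G) : x ∈ c.background := ⟨0, by simpa using h⟩

theorem eqOn_Icc_of_quasiperiodic {f g : ℝ → ℂ} {e : ℂ} {L : ℝ} (hL : 0 < L) (he : e ≠ 0)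
    (hf : ∀ x, f (x + L) = e * f x) (hg : ∀ x, g (x + L) = e * g x)
    (h : ∀ x ∈ Set.Icc 0 L, f x = g x) : f = g := by
  have key : Function.Periodic (fun x => f x = g x) L := fun x => by
    simp only [hf, hg, mul_right_inj' he]
  ext x
  obtain ⟨y, hy, hxy⟩ := key.exists_mem_Ico₀ hL x
  exact hxy.mpr (h y ⟨hy.1, hy.2.le⟩)

variable {c δ ω y z}

/-- The state at the centre of the second gap is computed in two ways: rightwards from the first
gap, and leftwards to `0`, then by quasiperiodicity to `L`, then back by half a gap. The leftward
path is the reflected rightward one, hence `-z`. -/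
theorem IsMode.exists_closes (hℓ : c.ℓ₁ = c.ℓ₂) (hδ : 0 < δ) {α : ℝ} {ψ : ℝ → ℂ}
    (h : c.IsMode δ α ω ψ) : ∃ y z : ℂ, c.Closes δ ω (Complex.exp (Complex.I * α * c.L)) y z ∧
      ∀ x ∈ Set.Icc 0 c.L, ψ x = c.cell δ ω y z x := by
  obtain ⟨hψ, hper, q, hq, hcr, hbg⟩ := h
  have p1 := c.ℓ₁_pos
  have p2 := c.s₁_pos
  have p3 := c.s₂_pos
  have hL : c.L = c.ℓ₁ + c.s₁ + c.ℓ₁ + c.s₂ := by unfold L; rw [← hℓ]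
  have hcr' : ∀ x ∈ c.D, HasDerivAt ψ (q x / (1 : ℝ)) x ∧
      HasDerivAt q (-(1 * (ω / c.vb) ^ 2 : ℝ) * ψ x) x := fun x hx => by
    simpa using hcr x (c.mem_crystal_of_mem_D hx)
  have hbg' : ∀ x ∈ c.G, HasDerivAt ψ (q x / δ) x ∧
      HasDerivAt q (-(δ * (ω / c.v) ^ 2 : ℝ) * ψ x) x := fun x hx =>
    hbg x (c.mem_background_of_mem_G hx)
  have u1 := @eq_wave (ω / c.vb) 1 0 c.ℓ₁ one_ne_zero ψ q hψ hq
    fun x hx => hcr' x (Or.inl hx)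
  have u2 := @eq_wave (ω / c.v) δ c.ℓ₁ (c.ℓ₁ + c.s₁) hδ.ne' ψ q hψ hq
    fun x hx => hbg' x (Or.inl hx)
  have u3 := @eq_wave (ω / c.vb) 1 (c.ℓ₁ + c.s₁) (c.ℓ₁ + c.s₁ + c.ℓ₁) one_ne_zero ψ q hψ hq
    fun x hx => hcr' x (Or.inr (by rwa [← hℓ]))
  have u4 := @eq_wave (ω / c.v) δ (c.ℓ₁ + c.s₁ + c.ℓ₁) c.L hδ.ne' ψ q hψ hq
    fun x hx => hbg' x (Or.inr (by rwa [← hℓ]))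
  set e := Complex.exp (Complex.I * α * c.L) with he
  -- Quasiperiodicity is assumed for `ψ` only. Inside a resonator `q = ψ'` inherits it, and
  -- continuity of `q` carries it to the end point `0`.
  have hperq : ∀ x ∈ Set.Ioo 0 c.ℓ₁, q (x + c.L) = e * q x := by
    intro x hx
    have h1 := (hcr (x + c.L) ⟨1, Or.inl (by simpa using hx)⟩).1.comp_add_const x c.L
    have h2 := (hcr x (c.mem_crystal_of_mem_D (Or.inl hx))).1.const_mul e
    rw [show (fun x => ψ (x + c.L)) = fun x => e * ψ x from funext hper] at h1
    exact h1.unique h2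
  have hq0 : q c.L = e * q 0 := by
    have hcl : Set.EqOn (fun x => q (x + c.L)) (fun x => e * q x) (closure (Set.Ioo 0 c.ℓ₁)) :=
      Set.EqOn.closure hperq (by fun_prop) (by fun_prop)
    rw [closure_Ioo p1.ne] at hcl
    simpa using hcl ⟨le_rfl, p1.le⟩
  have hψ0 : ψ c.L = e * ψ 0 := by simpa using hper 0
  set y := ψ (c.ℓ₁ + c.s₁ / 2) with hy
  set z := q (c.ℓ₁ + c.s₁ / 2) with hz
  have v2 := fun t ht => u2 (s := c.ℓ₁ + c.s₁ / 2) (t := t) ⟨by linarith, by linarith⟩ ht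
  have w1 := v2 c.ℓ₁ ⟨le_rfl, by linarith⟩
  rw [show c.ℓ₁ - (c.ℓ₁ + c.s₁ / 2) = -(c.s₁ / 2) by ring, wave_neg, flux_neg] at w1
  have w2 := v2 (c.ℓ₁ + c.s₁) ⟨by linarith, le_rfl⟩
  rw [show c.ℓ₁ + c.s₁ - (c.ℓ₁ + c.s₁ / 2) = c.s₁ / 2 by ring] at w2
  have v1 := fun t ht => u1 (s := c.ℓ₁) (t := t) ⟨by linarith, le_rfl⟩ ht
  have v3 := fun t ht => u3 (s := c.ℓ₁ + c.s₁) (t := t) ⟨le_rfl, by linarith⟩ ht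
  have w0 := v1 0 ⟨le_rfl, p1.le⟩
  rw [w1.1, w1.2, zero_sub, wave_neg, flux_neg, neg_neg] at w0
  have w3 := v3 (c.ℓ₁ + c.s₁ + c.ℓ₁) ⟨by linarith, le_rfl⟩
  rw [w2.1, w2.2, add_sub_cancel_left] at w3
  have m4 : c.ℓ₁ + c.s₁ + c.ℓ₁ + c.s₂ / 2 ∈ Set.Icc (c.ℓ₁ + c.s₁ + c.ℓ₁) c.L :=
    ⟨by linarith, by linarith⟩
  have w4 := u4 (s := c.ℓ₁ + c.s₁ + c.ℓ₁) ⟨by linarith, by linarith⟩ m4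
  rw [w3.1, w3.2, add_sub_cancel_left] at w4
  have w5 := u4 (s := c.L) ⟨by linarith, by linarith⟩ m4
  rw [hψ0, hq0, wave_smul, flux_smul, show c.ℓ₁ + c.s₁ + c.ℓ₁ + c.s₂ / 2 - c.L = -(c.s₂ / 2) by
    rw [hL]; ring, wave_neg, flux_neg, w0.1, w0.2, neg_neg] at w5
  refine ⟨y, z, ⟨w4.1.symm.trans w5.1, ?_⟩, fun x hx => ?_⟩
  · rw [← mul_neg]; exact w4.2.symm.trans w5.2
  · unfold cell
    split_ifs with h1 h2 h3
    · have := (v1 x ⟨hx.1, h1⟩).1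
      rw [w1.1, w1.2, ← neg_sub, wave_neg, neg_neg] at this
      exact this
    · exact (v2 x ⟨by linarith, h2⟩).1
    · have := (v3 x ⟨by linarith, h3⟩).1
      rwa [w2.1, w2.2] at this
    · have := (u4 m4 (t := x) ⟨by linarith, hx.2⟩).1
      rwa [w4.1, w4.2] at this

variable (c δ ω y z) in
theorem continuous_cell (hδ : 0 < δ) : Continuous (c.cell δ ω y z) := by
  unfold cell
  refine Continuous.if_le (by fun_prop) (Continuous.if_le (by fun_prop) (Continuous.if_le
    (by fun_prop) (by fun_prop) (by fun_prop) (by fun_prop) ?_) (by fun_prop) (by fun_prop) ?_)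
    (by fun_prop) (by fun_prop) ?_
  · rintro x rfl
    rw [farP, farR, show c.ℓ₁ + c.s₁ + c.ℓ₁ - (c.ℓ₁ + c.s₁ + c.ℓ₁ + c.s₂ / 2) = -(c.s₂ / 2) by ring,
      ← wave_add _ _ _ _ _ hδ.ne', add_neg_cancel, wave_zero, add_sub_cancel_left, endP]
  · rintro x rfl
    have := c.ℓ₁_pos
    rw [if_pos (by linarith), sub_self, wave_zero, resP]
    congr 1; ring
  · rintro x rfl
    have := c.s₁_pos
    rw [if_pos (by linarith), sub_self, wave_zero, resP, ← wave_neg]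
    congr 1; ring

variable (c δ ω y z) in
theorem continuous_cellFlux (hδ : 0 < δ) : Continuous (c.cellFlux δ ω y z) := by
  unfold cellFlux
  refine Continuous.if_le (by fun_prop) (Continuous.if_le (by fun_prop) (Continuous.if_le
    (by fun_prop) (by fun_prop) (by fun_prop) (by fun_prop) ?_) (by fun_prop) (by fun_prop) ?_)
    (by fun_prop) (by fun_prop) ?_
  · rintro x rfl
    rw [farP, farR, show c.ℓ₁ + c.s₁ + c.ℓ₁ - (c.ℓ₁ + c.s₁ + c.ℓ₁ + c.s₂ / 2) = -(c.s₂ / 2) by ring,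
      ← flux_add _ _ _ _ _ hδ.ne', add_neg_cancel, flux_zero, add_sub_cancel_left, endR]
  · rintro x rfl
    have := c.ℓ₁_pos
    rw [if_pos (by linarith), sub_self, flux_zero, resR]
    congr 1; ring
  · rintro x rfl
    have := c.s₁_pos
    rw [if_pos (by linarith), sub_self, flux_zero, resR, ← flux_neg]
    congr 1; ring

variable (c δ ω y z) in
theorem hasDerivAt_cell_of_mem_D (hℓ : c.ℓ₁ = c.ℓ₂) {x : ℝ} (hx : x ∈ c.D) :
    HasDerivAt (c.cell δ ω y z) (c.cellFlux δ ω y z x) x ∧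
    HasDerivAt (c.cellFlux δ ω y z) (-((ω / c.vb) ^ 2 : ℝ) * c.cell δ ω y z x) x := by
  have p1 := c.ℓ₁_pos
  have p2 := c.s₁_pos
  rcases hx with hx | hx
  · have e1 : c.cell δ ω y z =ᶠ[𝓝 x] fun x =>
        wave (ω / c.vb) 1 (c.resP δ ω y (-z)) (c.resR δ ω y (-z)) (c.ℓ₁ - x) := by
      filter_upwards [isOpen_Ioo.mem_nhds hx] with t ht
      simp only [cell, if_pos ht.2.le]
    have e2 : c.cellFlux δ ω y z =ᶠ[𝓝 x] fun x =>
        -flux (ω / c.vb) 1 (c.resP δ ω y (-z)) (c.resR δ ω y (-z)) (c.ℓ₁ - x) := by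
      filter_upwards [isOpen_Ioo.mem_nhds hx] with t ht
      simp only [cellFlux, if_pos ht.2.le]
    constructor
    · refine HasDerivAt.congr_of_eventuallyEq ?_ e1
      refine ((hasDerivAt_wave _ _ _ _ one_ne_zero).scomp x
        ((hasDerivAt_id x).const_sub c.ℓ₁)).congr_deriv ?_
      simp [e2.self_of_nhds]
    · refine HasDerivAt.congr_of_eventuallyEq ?_ e2
      refine (((hasDerivAt_flux _ _ _ _ one_ne_zero).scomp x
        ((hasDerivAt_id x).const_sub c.ℓ₁)).neg).congr_deriv ?_
      simp [e1.self_of_nhds]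
  · rw [← hℓ] at hx
    have e1 : c.cell δ ω y z =ᶠ[𝓝 x] fun x =>
        wave (ω / c.vb) 1 (c.resP δ ω y z) (c.resR δ ω y z) (x - (c.ℓ₁ + c.s₁)) := by
      filter_upwards [isOpen_Ioo.mem_nhds hx] with t ht
      simp only [cell, if_pos ht.2.le, if_neg ht.1.not_ge,
        if_neg (show ¬ t ≤ c.ℓ₁ by linarith [ht.1])]
    have e2 : c.cellFlux δ ω y z =ᶠ[𝓝 x] fun x =>
        flux (ω / c.vb) 1 (c.resP δ ω y z) (c.resR δ ω y z) (x - (c.ℓ₁ + c.s₁)) := by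
      filter_upwards [isOpen_Ioo.mem_nhds hx] with t ht
      simp only [cellFlux, if_pos ht.2.le, if_neg ht.1.not_ge,
        if_neg (show ¬ t ≤ c.ℓ₁ by linarith [ht.1])]
    constructor
    · refine HasDerivAt.congr_of_eventuallyEq ?_ e1
      refine ((hasDerivAt_wave _ _ _ _ one_ne_zero).comp_sub_const x _).congr_deriv ?_
      simp [e2.self_of_nhds]
    · refine HasDerivAt.congr_of_eventuallyEq ?_ e2
      refine ((hasDerivAt_flux _ _ _ _ one_ne_zero).comp_sub_const x _).congr_deriv ?_
      simp [e1.self_of_nhds]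

variable (c δ ω y z) in
theorem hasDerivAt_cell_of_mem_G (hℓ : c.ℓ₁ = c.ℓ₂) (hδ : 0 < δ) {x : ℝ} (hx : x ∈ c.G) :
    HasDerivAt (c.cell δ ω y z) (c.cellFlux δ ω y z x / δ) x ∧
    HasDerivAt (c.cellFlux δ ω y z) (-(δ * (ω / c.v) ^ 2 : ℝ) * c.cell δ ω y z x) x := by
  have p1 := c.ℓ₁_pos
  have p2 := c.s₁_pos
  rcases hx with hx | hx
  · have e1 : c.cell δ ω y z =ᶠ[𝓝 x] fun x =>
        wave (ω / c.v) δ y z (x - (c.ℓ₁ + c.s₁ / 2)) := by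
      filter_upwards [isOpen_Ioo.mem_nhds hx] with t ht
      simp only [cell, if_neg ht.1.not_ge, if_pos ht.2.le]
    have e2 : c.cellFlux δ ω y z =ᶠ[𝓝 x] fun x =>
        flux (ω / c.v) δ y z (x - (c.ℓ₁ + c.s₁ / 2)) := by
      filter_upwards [isOpen_Ioo.mem_nhds hx] with t ht
      simp only [cellFlux, if_neg ht.1.not_ge, if_pos ht.2.le]
    constructor
    · refine HasDerivAt.congr_of_eventuallyEq ?_ e1
      refine ((hasDerivAt_wave _ _ _ _ hδ.ne').comp_sub_const x _).congr_deriv ?_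
      rw [e2.self_of_nhds]
    · refine HasDerivAt.congr_of_eventuallyEq ?_ e2
      refine ((hasDerivAt_flux _ _ _ _ hδ.ne').comp_sub_const x _).congr_deriv ?_
      rw [e1.self_of_nhds]
  · rw [← hℓ] at hx
    have n1 : ∀ t ∈ Set.Ioo (c.ℓ₁ + c.s₁ + c.ℓ₁) c.L, ¬ t ≤ c.ℓ₁ := fun t ht => by
      linarith [ht.1]
    have n2 : ∀ t ∈ Set.Ioo (c.ℓ₁ + c.s₁ + c.ℓ₁) c.L, ¬ t ≤ c.ℓ₁ + c.s₁ := fun t ht => by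
      linarith [ht.1]
    have e1 : c.cell δ ω y z =ᶠ[𝓝 x] fun x => wave (ω / c.v) δ (c.farP δ ω y z) (c.farR δ ω y z)
        (x - (c.ℓ₁ + c.s₁ + c.ℓ₁ + c.s₂ / 2)) := by
      filter_upwards [isOpen_Ioo.mem_nhds hx] with t ht
      simp only [cell, if_neg ht.1.not_ge, if_neg (n1 t ht), if_neg (n2 t ht)]
    have e2 : c.cellFlux δ ω y z =ᶠ[𝓝 x] fun x =>
        flux (ω / c.v) δ (c.farP δ ω y z) (c.farR δ ω y z)
        (x - (c.ℓ₁ + c.s₁ + c.ℓ₁ + c.s₂ / 2)) := by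
      filter_upwards [isOpen_Ioo.mem_nhds hx] with t ht
      simp only [cellFlux, if_neg ht.1.not_ge, if_neg (n1 t ht), if_neg (n2 t ht)]
    constructor
    · refine HasDerivAt.congr_of_eventuallyEq ?_ e1
      refine ((hasDerivAt_wave _ _ _ _ hδ.ne').comp_sub_const x _).congr_deriv ?_
      rw [e2.self_of_nhds]
    · refine HasDerivAt.congr_of_eventuallyEq ?_ e2
      refine ((hasDerivAt_flux _ _ _ _ hδ.ne').comp_sub_const x _).congr_deriv ?_
      rw [e1.self_of_nhds]

/-- A function on `[0, L]` whose end values differ by the phase `exp (i α L)` has a continuous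
quasiperiodic extension. -/
theorem exists_quasiperiodic_extension {L : ℝ} (hL : 0 < L) (α : ℝ) {f : ℝ → ℂ}
    (hf : Continuous f) (h : f L = Complex.exp (Complex.I * α * L) * f 0) :
    ∃ g : ℝ → ℂ, Continuous g ∧ (∀ x, g (x + L) = Complex.exp (Complex.I * α * L) * g x) ∧
      ∀ (n : ℤ) (x : ℝ), x - n * L ∈ Set.Ico 0 L →
        g x = Complex.exp (Complex.I * α * L * n) * f (x - n * L) := by
  have : Fact (0 < L) := ⟨hL⟩
  -- Removing the phase leaves equal end values, hence a continuous function on the circle.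
  let f₀ : ℝ → ℂ := fun x => Complex.exp (-(Complex.I * α * x)) * f x
  have hf₀ : f₀ 0 = f₀ L := by
    simp only [f₀, h]
    rw [← mul_assoc, ← Complex.exp_add]
    simp
  refine ⟨fun x => Complex.exp (Complex.I * α * x) * AddCircle.liftIco L 0 f₀ (x : AddCircle L),
    ?_, fun x => ?_, fun n x hx => ?_⟩
  · have h1 : Continuous (AddCircle.liftIco L 0 f₀) :=
      AddCircle.liftIco_zero_continuous hf₀ (Continuous.continuousOn (by fun_prop))
    exact (by fun_prop : Continuous fun x : ℝ => Complex.exp (Complex.I * α * x)).mul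
      (h1.comp (AddCircle.continuous_mk' L))
  · simp only [AddCircle.coe_add_period]
    rw [← mul_assoc, ← Complex.exp_add]
    push_cast
    ring_nf
  · have h1 : (x : AddCircle L) = ((x - n * L : ℝ) : AddCircle L) := by
      rw [AddCircle.coe_sub, ← zsmul_eq_mul, AddCircle.coe_zsmul, AddCircle.coe_period]
      simp
    simp only [h1, AddCircle.liftIco_zero_coe_apply hx, f₀]
    rw [← mul_assoc, ← Complex.exp_add]
    push_cast
    ring_nf

/-- Propagated from the centre of the second gap to `L`, the closing conditions say that both `cell`
and `cellFlux` pick up the phase over the cell. The cells are glued at end points of resonators,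
where no differential equation is imposed, so continuity of both functions suffices. -/
theorem Closes.exists_isMode (hℓ : c.ℓ₁ = c.ℓ₂) (hδ : 0 < δ) {α : ℝ}
    (h : c.Closes δ ω (Complex.exp (Complex.I * α * c.L)) y z) :
    ∃ ψ : ℝ → ℂ, c.IsMode δ α ω ψ ∧ ∀ x ∈ Set.Ico 0 c.L, ψ x = c.cell δ ω y z x := by
  have p1 := c.ℓ₁_pos
  have p2 := c.s₁_pos
  have p3 := c.s₂_pos
  have hL : c.L = c.ℓ₁ + c.s₁ + c.ℓ₁ + c.s₂ := by unfold L; rw [← hℓ]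
  have n1 : ¬ c.L ≤ c.ℓ₁ := by linarith
  have n2 : ¬ c.L ≤ c.ℓ₁ + c.s₁ := by linarith
  have n3 : ¬ c.L ≤ c.ℓ₁ + c.s₁ + c.ℓ₁ := by linarith
  have e1 : c.L - (c.ℓ₁ + c.s₁ + c.ℓ₁ + c.s₂ / 2) = c.s₂ / 2 := by rw [hL]; ring
  obtain ⟨ψ, hψ, hψp, hψn⟩ := exists_quasiperiodic_extension c.L_pos α
    (c.continuous_cell δ ω y z hδ) (by
      rw [cell, cell, if_neg n1, if_neg n2, if_neg n3, if_pos p1.le, e1, h.1, h.2, ← mul_neg,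
        wave_smul, ← wave_neg, farP, farR, ← wave_add _ _ _ _ _ hδ.ne', add_neg_cancel, wave_zero,
        sub_zero, endP])
  obtain ⟨q, hq, hqp, hqn⟩ := exists_quasiperiodic_extension c.L_pos α
    (c.continuous_cellFlux δ ω y z hδ) (by
      rw [cellFlux, cellFlux, if_neg n1, if_neg n2, if_neg n3, if_pos p1.le, e1, h.1, h.2,
        ← mul_neg, flux_smul, ← neg_neg (flux (ω / c.v) _ _ _ _), ← flux_neg, farP, farR,
        ← flux_add _ _ _ _ _ hδ.ne', add_neg_cancel, flux_zero, sub_zero, endR])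
  have hev : ∀ {n : ℤ} {x : ℝ}, x - n * c.L ∈ Set.Ioo 0 c.L →
      (ψ =ᶠ[𝓝 x] fun x => Complex.exp (Complex.I * α * c.L * n) * c.cell δ ω y z (x - n * c.L)) ∧
      (q =ᶠ[𝓝 x] fun x => Complex.exp (Complex.I * α * c.L * n) *
        c.cellFlux δ ω y z (x - n * c.L)) := by
    intro n x hx
    have : ∀ᶠ t in 𝓝 x, t - n * c.L ∈ Set.Ioo 0 c.L :=
      (by fun_prop : ContinuousAt (fun t : ℝ => t - n * c.L) x).eventually_mem
        (isOpen_Ioo.mem_nhds hx)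
    exact ⟨this.mono fun t ht => hψn n t ⟨ht.1.le, ht.2⟩,
      this.mono fun t ht => hqn n t ⟨ht.1.le, ht.2⟩⟩
  refine ⟨ψ, ⟨hψ, hψp, q, hq, ?_, ?_⟩, fun x hx => by simpa using hψn 0 x (by simpa using hx)⟩
  · rintro x ⟨n, hn⟩
    have hm : x - n * c.L ∈ Set.Ioo 0 c.L := by
      rcases hn with hn | hn
      · exact ⟨hn.1, by linarith [hn.2]⟩
      · rw [← hℓ] at hn
        exact ⟨by linarith [hn.1], by linarith [hn.2]⟩
    obtain ⟨g1, g2⟩ := hev hm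
    obtain ⟨d1, d2⟩ := c.hasDerivAt_cell_of_mem_D δ ω y z hℓ hn
    constructor
    · refine (((d1.comp_sub_const x _).const_mul _).congr_of_eventuallyEq g1).congr_deriv ?_
      rw [g2.self_of_nhds]
    · refine (((d2.comp_sub_const x _).const_mul _).congr_of_eventuallyEq g2).congr_deriv ?_
      rw [g1.self_of_nhds]; ring
  · rintro x ⟨n, hn⟩
    have hm : x - n * c.L ∈ Set.Ioo 0 c.L := by
      rcases hn with hn | hn
      · exact ⟨by linarith [hn.1], by linarith [hn.2]⟩
      · exact ⟨by linarith [hn.1, c.ℓ₂_pos], hn.2⟩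
    obtain ⟨g1, g2⟩ := hev hm
    obtain ⟨d1, d2⟩ := c.hasDerivAt_cell_of_mem_G δ ω y z hℓ hδ hn
    constructor
    · refine (((d1.comp_sub_const x _).const_mul _).congr_of_eventuallyEq g1).congr_deriv ?_
      rw [g2.self_of_nhds]; ring
    · refine (((d2.comp_sub_const x _).const_mul _).congr_of_eventuallyEq g2).congr_deriv ?_
      rw [g1.self_of_nhds]; ring

variable (c δ ω) in
theorem cell_zero (x : ℝ) : c.cell δ ω 0 0 x = 0 := by
  simpa using c.cell_smul δ ω 0 0 0 x

/-- A solution that vanishes in the second resonator vanishes. -/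
theorem eq_zero_of_cell_eq_zero (hℓ : c.ℓ₁ = c.ℓ₂) (hδ : 0 < δ)
    (h : ∀ x ∈ c.D, c.cell δ ω y z x = 0) : y = 0 ∧ z = 0 := by
  have p1 := c.ℓ₁_pos
  have p2 := c.s₁_pos
  have h1 := eq_zero_of_wave_eq_zero (ω / c.vb) (ρ := 1) (p := c.resP δ ω y z)
    (r := c.resR δ ω y z) one_ne_zero p1 fun t ht => by
      have := h (t + (c.ℓ₁ + c.s₁)) (Or.inr ⟨by linarith [ht.1], by rw [← hℓ]; linarith [ht.2]⟩)
      rwa [cell, if_neg (by linarith [ht.1]), if_neg (by linarith [ht.1]),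
        if_pos (by linarith [ht.2]), add_sub_cancel_right] at this
  have h2 := wave_add (ω / c.v) y z (c.s₁ / 2) (-(c.s₁ / 2)) hδ.ne'
  have h3 := flux_add (ω / c.v) y z (c.s₁ / 2) (-(c.s₁ / 2)) hδ.ne'
  rw [resP, resR] at h1
  rw [h1.1, h1.2, add_neg_cancel, wave_zero] at h2
  rw [h1.1, h1.2, add_neg_cancel, flux_zero] at h3
  constructor
  · simpa [wave] using h2
  · simpa [flux] using h3

theorem IsMode.eq_of_eqOn (α : ℝ) {ψ φ : ℝ → ℂ} (hψ : c.IsMode δ α ω ψ)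
    (hφ : ∀ x, φ (x + c.L) = Complex.exp (Complex.I * α * c.L) * φ x)
    (h : ∀ x ∈ Set.Icc 0 c.L, ψ x = φ x) : ψ = φ :=
  eqOn_Icc_of_quasiperiodic c.L_pos (Complex.exp_ne_zero _) hψ.2.1 hφ h

end DimerChain
namespace DimerChain

/-! ### The transfer matrix from the centre of the first gap to the centre of the second -/

/-- The diagonal entries of the transfer matrix as functions of the frequency. -/
noncomputable def entry (r X Y₁ Y₂ ω : ℝ) : ℝ :=
  Real.cos (X * ω) * Real.cos ((Y₁ + Y₂) * ω) - Real.sin (X * ω) *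
    (r⁻¹ * (Real.sin (Y₁ * ω) * Real.cos (Y₂ * ω)) + r * (Real.sin (Y₂ * ω) * Real.cos (Y₁ * ω)))

/-- The ratio of the impedances of background and resonators. -/
noncomputable def ratio (c : DimerChain) (δ : ℝ) : ℝ := c.v / (c.vb * δ)

noncomputable def tA (c : DimerChain) (δ ω : ℝ) : ℝ :=
  entry (c.ratio δ) (c.ℓ₁ / c.vb) (c.s₁ / (2 * c.v)) (c.s₂ / (2 * c.v)) ω

noncomputable def tD (c : DimerChain) (δ ω : ℝ) : ℝ :=
  entry (c.ratio δ) (c.ℓ₁ / c.vb) (c.s₂ / (2 * c.v)) (c.s₁ / (2 * c.v)) ω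

/-- The only entry whose sine form divides by `ω`; `sn` keeps it regular at `ω = 0`, where the lower
band touches. -/
noncomputable def tB (c : DimerChain) (δ ω : ℝ) : ℝ :=
  Real.cos (ω / c.vb * c.ℓ₁) * sn (ω / c.v) (c.s₁ / 2 + c.s₂ / 2) / δ
    + sn (ω / c.vb) c.ℓ₁ * (Real.cos (ω / c.v * (c.s₁ / 2)) * Real.cos (ω / c.v * (c.s₂ / 2))
      - (ω / c.vb) ^ 2 * sn (ω / c.v) (c.s₁ / 2) * sn (ω / c.v) (c.s₂ / 2) / δ ^ 2)

noncomputable def tC (c : DimerChain) (δ ω : ℝ) : ℝ :=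
  -(δ * ω / c.v * (Real.cos (c.ℓ₁ / c.vb * ω) *
      Real.sin ((c.s₁ / (2 * c.v) + c.s₂ / (2 * c.v)) * ω)
    + Real.sin (c.ℓ₁ / c.vb * ω) *
      (c.ratio δ * (Real.cos (c.s₁ / (2 * c.v) * ω) * Real.cos (c.s₂ / (2 * c.v) * ω))
      - (c.ratio δ)⁻¹ * (Real.sin (c.s₁ / (2 * c.v) * ω) * Real.sin (c.s₂ / (2 * c.v) * ω)))))

section
variable (c : DimerChain) {δ : ℝ} (hδ : 0 < δ) (ω : ℝ) (y z : ℂ)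

theorem args : c.ℓ₁ / c.vb * ω = ω / c.vb * c.ℓ₁ ∧ c.s₁ / (2 * c.v) * ω = ω / c.v * (c.s₁ / 2) ∧
    c.s₂ / (2 * c.v) * ω = ω / c.v * (c.s₂ / 2) := by
  have := c.v_pos.ne'
  refine ⟨by ring, by field_simp, by field_simp⟩

include hδ

theorem farP_eq : c.farP δ ω y z = c.tA δ ω * y + c.tB δ ω * z := by
  have h1 := c.v_pos.ne'
  have h2 := c.vb_pos.ne'
  have h3 : (c.v : ℂ) ≠ 0 := by exact_mod_cast h1
  have h4 : (c.vb : ℂ) ≠ 0 := by exact_mod_cast h2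
  have h5 : (δ : ℂ) ≠ 0 := by exact_mod_cast hδ.ne'
  obtain ⟨e1, e2, e3⟩ := c.args ω
  simp only [farP, endP, endR, resP, resR, wave, flux, tA, tB, entry, ratio, add_mul, sn_add,
    Real.cos_add, e1, e2, e3, ← mul_sn]
  push_cast
  field_simp
  ring

theorem farR_eq : c.farR δ ω y z = c.tC δ ω * y + c.tD δ ω * z := by
  have h1 := c.v_pos.ne'
  have h2 := c.vb_pos.ne'
  have h3 : (c.v : ℂ) ≠ 0 := by exact_mod_cast h1
  have h4 : (c.vb : ℂ) ≠ 0 := by exact_mod_cast h2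
  have h5 : (δ : ℂ) ≠ 0 := by exact_mod_cast hδ.ne'
  obtain ⟨e1, e2, e3⟩ := c.args ω
  simp only [farR, endP, endR, resP, resR, wave, flux, tC, tD, entry, ratio, add_mul, Real.sin_add,
    Real.cos_add, e1, e2, e3, ← mul_sn]
  push_cast
  field_simp
  ring

-- Each propagation matrix has determinant `cos² + κ² sn² = 1`.
omit hδ in
theorem wronskian {κ ρ : ℝ} (hρ : ρ ≠ 0) (p r p' r' : ℂ) (y : ℝ) :
    wave κ ρ p r y * flux κ ρ p' r' y - wave κ ρ p' r' y * flux κ ρ p r y = p * r' - p' * r := by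
  have h : ((Real.cos (κ * y) : ℝ) : ℂ) ^ 2 + κ ^ 2 * (sn κ y : ℝ) ^ 2 = 1 := by
    exact_mod_cast cos_sq_add_sn_sq κ y
  have : (ρ : ℂ) ≠ 0 := by exact_mod_cast hρ
  have e : wave κ ρ p r y * flux κ ρ p' r' y - wave κ ρ p' r' y * flux κ ρ p r y =
      (p * r' - p' * r) * (((Real.cos (κ * y) : ℝ) : ℂ) ^ 2 + κ ^ 2 * (sn κ y : ℝ) ^ 2) := by
    simp only [wave, flux]; field_simp; ring
  rw [e, h, mul_one]

theorem det_transfer : c.tA δ ω * c.tD δ ω - c.tB δ ω * c.tC δ ω = 1 := by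
  have h : c.farP δ ω 1 0 * c.farR δ ω 0 1 - c.farP δ ω 0 1 * c.farR δ ω 1 0 = 1 := by
    simp only [farP, farR, endP, endR, resP, resR]
    rw [wronskian hδ.ne', wronskian one_ne_zero, wronskian hδ.ne']
    simp
  rw [c.farP_eq hδ, c.farP_eq hδ, c.farR_eq hδ, c.farR_eq hδ] at h
  simp only [mul_one, mul_zero, add_zero, zero_add] at h
  exact_mod_cast h

/-- Multiplying by the half phase `exp (-iαL/2)` symmetrises the two conditions, so that only `cos
(αL/2)` and `sin (αL/2)` remain. -/
theorem closes_iff (α : ℝ) : c.Closes δ ω (Complex.exp (Complex.I * α * c.L)) y z ↔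
    (c.tB δ ω * Real.cos (α * c.L / 2) * z : ℂ) = Complex.I * Real.sin (α * c.L / 2) * c.tA δ ω * y
    ∧ (c.tC δ ω * Real.cos (α * c.L / 2) * y : ℂ)
      = Complex.I * Real.sin (α * c.L / 2) * c.tD δ ω * z := by
  have he : Complex.exp (Complex.I * α * c.L) =
      ((Real.cos (α * c.L / 2) : ℝ) + Complex.I * (Real.sin (α * c.L / 2) : ℝ)) ^ 2 := by
    have : Complex.I * α * c.L = (2 : ℕ) * (((α * c.L / 2 : ℝ) : ℂ) * Complex.I) := by
      push_cast; ring
    rw [this, Complex.exp_nat_mul, Complex.exp_mul_I, Complex.ofReal_cos, Complex.ofReal_sin]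
    ring
  have h1 : ((Real.cos (α * c.L / 2) : ℝ) : ℂ) ^ 2 + (Real.sin (α * c.L / 2) : ℝ) ^ 2 = 1 := by
    exact_mod_cast Real.cos_sq_add_sin_sq _
  unfold Closes
  simp only [c.farP_eq hδ, c.farR_eq hδ, he]
  generalize ((Real.cos (α * c.L / 2) : ℝ) : ℂ) = t at *
  generalize ((Real.sin (α * c.L / 2) : ℝ) : ℂ) = s at *
  have hI := Complex.I_sq
  have hu : (t - Complex.I * s) * (t + Complex.I * s) = 1 := by
    linear_combination h1 - s ^ 2 * hI
  have hu1 : t + Complex.I * s ≠ 0 := right_ne_zero_of_mul_eq_one hu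
  have hu2 : t - Complex.I * s ≠ 0 := left_ne_zero_of_mul_eq_one hu
  constructor
  · rintro ⟨e1, e2⟩
    constructor
    · linear_combination (1 / 2 * (t - Complex.I * s)) * e1 + (1 / 2 *
        (t + Complex.I * s) * (c.tA δ ω * y - c.tB δ ω * z)) * hu
    · linear_combination (1 / 2 * (t - Complex.I * s)) * e2 - (1 / 2 *
        (t + Complex.I * s) * (c.tC δ ω * y - c.tD δ ω * z)) * hu
  · rintro ⟨e1, e2⟩
    constructor
    · linear_combination (2 * (t + Complex.I * s)) * e1 - (c.tA δ ω * y + c.tB δ ω * z) * hu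
    · linear_combination (2 * (t + Complex.I * s)) * e2 - (c.tC δ ω * y + c.tD δ ω * z) * hu

end

/-! ### Monotonicity at low frequencies -/

/-- The frequency `ω` is low for a chain with the time scales `X`, `Y₁`, `Y₂`. -/
structure Low (X Y₁ Y₂ ω : ℝ) : Prop where
  sinX : 0 < Real.sin (X * ω)
  cosX : 0 < Real.cos (X * ω)
  sin₁ : 0 < Real.sin (Y₁ * ω)
  sin₂ : 0 < Real.sin (Y₂ * ω)
  cos₁ : 0 < Real.cos (Y₁ * ω)
  cos₂ : 0 < Real.cos (Y₂ * ω)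
  cosY : 0 < Real.cos ((Y₁ + Y₂) * ω)
  lt₁ : Y₂ * (Real.sin (Y₁ * ω) * Real.sin (Y₂ * ω)) < Y₁ * (Real.cos (Y₁ * ω) * Real.cos (Y₂ * ω))
  lt₂ : Y₁ * (Real.sin (Y₁ * ω) * Real.sin (Y₂ * ω)) < Y₂ * (Real.cos (Y₁ * ω) * Real.cos (Y₂ * ω))

theorem Low.symm {X Y₁ Y₂ ω : ℝ} (h : Low X Y₁ Y₂ ω) : Low X Y₂ Y₁ ω where
  sinX := h.sinX
  cosX := h.cosX
  sin₁ := h.sin₂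
  sin₂ := h.sin₁
  cos₁ := h.cos₂
  cos₂ := h.cos₁
  cosY := by rw [add_comm]; exact h.cosY
  lt₁ := by have := h.lt₂; linarith
  lt₂ := by have := h.lt₁; linarith

theorem eventually_sin_pos {X : ℝ} (hX : 0 < X) : ∀ᶠ ω in 𝓝[>] (0 : ℝ), 0 < Real.sin (X * ω) := by
  have h : ∀ᶠ ω in 𝓝[>] (0 : ℝ), X * ω < Real.pi :=
    ((by fun_prop : Continuous fun ω => X * ω).continuousAt.mono_left nhdsWithin_le_nhds)
      |>.eventually_lt_const (by simpa using Real.pi_pos)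
  filter_upwards [h, self_mem_nhdsWithin] with ω h1 h2
  exact Real.sin_pos_of_pos_of_lt_pi (mul_pos hX h2) h1

theorem eventually_low {X Y₁ Y₂ : ℝ} (hX : 0 < X) (h₁ : 0 < Y₁) (h₂ : 0 < Y₂) :
    ∀ᶠ ω in 𝓝[>] (0 : ℝ), Low X Y₁ Y₂ ω := by
  have key : ∀ {f : ℝ → ℝ}, Continuous f → 0 < f 0 → ∀ᶠ ω in 𝓝[>] (0 : ℝ), 0 < f ω :=
    fun hf h0 => (hf.continuousAt.mono_left nhdsWithin_le_nhds).eventually_const_lt h0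
  filter_upwards [eventually_sin_pos hX, eventually_sin_pos h₁, eventually_sin_pos h₂,
    key (f := fun ω => Real.cos (X * ω)) (by fun_prop) (by simp),
    key (f := fun ω => Real.cos (Y₁ * ω)) (by fun_prop) (by simp),
    key (f := fun ω => Real.cos (Y₂ * ω)) (by fun_prop) (by simp),
    key (f := fun ω => Real.cos ((Y₁ + Y₂) * ω)) (by fun_prop) (by simp),
    key (f := fun ω => Y₁ * (Real.cos (Y₁ * ω) * Real.cos (Y₂ * ω)) -
      Y₂ * (Real.sin (Y₁ * ω) * Real.sin (Y₂ * ω))) (by fun_prop) (by simpa),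
    key (f := fun ω => Y₂ * (Real.cos (Y₁ * ω) * Real.cos (Y₂ * ω)) -
      Y₁ * (Real.sin (Y₁ * ω) * Real.sin (Y₂ * ω))) (by fun_prop) (by simpa)]
    with ω a1 a2 a3 a4 a5 a6 a7 a8 a9
  exact ⟨a1, a4, a2, a3, a5, a6, a7, by linarith, by linarith⟩

@[fun_prop]
theorem continuous_entry (r X Y₁ Y₂ : ℝ) : Continuous (entry r X Y₁ Y₂) := by
  unfold entry; fun_prop

/-- Every group of terms in the derivative is negative; `lt₁` and `lt₂` say that the two products
`sin · cos` in `entry` increase. This works for every `r > 0`, so the range of low frequencies does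
not depend on the contrast. -/
theorem hasDerivAt_entry {r X Y₁ Y₂ ω : ℝ} (hr : 0 < r) (hX : 0 < X) (h₁ : 0 < Y₁) (h₂ : 0 < Y₂)
    (h : Low X Y₁ Y₂ ω) : ∃ a' < 0, HasDerivAt (entry r X Y₁ Y₂) a' ω := by
  have hs (Z : ℝ) : HasDerivAt (fun ω => Real.sin (Z * ω)) (Z * Real.cos (Z * ω)) ω := by
    simpa [mul_comm] using ((hasDerivAt_id' ω).const_mul Z).sin
  have hc (Z : ℝ) : HasDerivAt (fun ω => Real.cos (Z * ω)) (-(Z * Real.sin (Z * ω))) ω := by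
    simpa [mul_comm] using ((hasDerivAt_id' ω).const_mul Z).cos
  refine ⟨_, ?_, ((hc X).mul (hc (Y₁ + Y₂))).sub ((hs X).mul
    ((((hs Y₁).mul (hc Y₂)).const_mul r⁻¹).add (((hs Y₂).mul (hc Y₁)).const_mul r)))⟩
  obtain ⟨a1, a2, a3, a4, a5, a6, a7, a8, a9⟩ := h
  have a10 : 0 < Real.sin ((Y₁ + Y₂) * ω) := by
    rw [add_mul, Real.sin_add]; positivity
  have hr' : 0 < r⁻¹ := inv_pos.2 hr
  have b1 : 0 < X * (Real.sin (X * ω) * Real.cos ((Y₁ + Y₂) * ω)) := by positivity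
  have b2 : 0 < Real.cos (X * ω) * ((Y₁ + Y₂) * Real.sin ((Y₁ + Y₂) * ω)) := by positivity
  have b3 : 0 < X * Real.cos (X * ω) * (r⁻¹ * (Real.sin (Y₁ * ω) * Real.cos (Y₂ * ω)) +
    r * (Real.sin (Y₂ * ω) * Real.cos (Y₁ * ω))) := by positivity
  have b4 : 0 < Real.sin (X * ω) * (r⁻¹ * (Y₁ * (Real.cos (Y₁ * ω) * Real.cos (Y₂ * ω)) -
    Y₂ * (Real.sin (Y₁ * ω) * Real.sin (Y₂ * ω)))) :=
    mul_pos a1 (mul_pos hr' (by linarith))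
  have b5 : 0 < Real.sin (X * ω) * (r * (Y₂ * (Real.cos (Y₁ * ω) * Real.cos (Y₂ * ω)) -
    Y₁ * (Real.sin (Y₁ * ω) * Real.sin (Y₂ * ω)))) :=
    mul_pos a1 (mul_pos hr (by linarith))
  linarith

/-- The cosine term is at most `1`, so a loss of `2` from the `r` term suffices; the positive `r⁻¹`
term is discarded. -/
theorem entry_lt_neg_one {r X Y₁ Y₂ ω : ℝ} (hr : 0 < r) (h : Low X Y₁ Y₂ ω)
    (hb : 2 < r * (Real.sin (X * ω) * (Real.sin (Y₂ * ω) * Real.cos (Y₁ * ω)))) :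
    entry r X Y₁ Y₂ ω < -1 := by
  have h1 : Real.cos (X * ω) * Real.cos ((Y₁ + Y₂) * ω) ≤ 1 :=
    mul_le_one₀ (Real.cos_le_one _) h.cosY.le (Real.cos_le_one _)
  have h2 : 0 < Real.sin (X * ω) * (r⁻¹ * (Real.sin (Y₁ * ω) * Real.cos (Y₂ * ω))) :=
    mul_pos h.sinX (mul_pos (inv_pos.2 hr) (mul_pos h.sin₁ h.cos₂))
  unfold entry
  linarith

/-- For `r > 1` and low frequency this has the sign of `Y₁ - Y₂`: here unequal gaps separate the two
diagonal entries. -/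
theorem entry_sub_entry (r X Y₁ Y₂ ω : ℝ) : entry r X Y₁ Y₂ ω - entry r X Y₂ Y₁ ω =
    (r - r⁻¹) * (Real.sin (X * ω) * Real.sin ((Y₁ - Y₂) * ω)) := by
  simp only [entry, sub_mul, Real.sin_sub, add_comm Y₂ Y₁]
  ring

end DimerChain
-- The dispersion relation and its two branches
namespace DimerChain

/-- For the contrast `δ` the frequencies in `[0, ε]` contain the two subwavelength bands, and
frequencies at `ε` lie above them. -/
structure Window (c : DimerChain) (δ ε : ℝ) : Prop where
  δ_pos : 0 < δ
  ε_pos : 0 < ε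
  a_zero : c.tA δ 0 = 1
  d_zero : c.tD δ 0 = 1
  c_zero : c.tC δ 0 = 0
  b_zero : 0 < c.tB δ 0
  a_end : c.tA δ ε < -1
  d_end : c.tD δ ε < -1
  a_deriv : ∀ ω ∈ Set.Ioc 0 ε, ∃ a' < 0, HasDerivAt (c.tA δ) a' ω
  d_deriv : ∀ ω ∈ Set.Ioc 0 ε, ∃ d' < 0, HasDerivAt (c.tD δ) d' ω
  d_lt_a : c.s₂ < c.s₁ → ∀ ω ∈ Set.Ioc 0 ε, c.tD δ ω < c.tA δ ω
  a_lt_d : c.s₁ < c.s₂ → ∀ ω ∈ Set.Ioc 0 ε, c.tA δ ω < c.tD δ ω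
  c_neg : ∀ ω ∈ Set.Ioc 0 ε, c.tC δ ω < 0

section
variable (c : DimerChain)

theorem tendsto_ratio : Tendsto c.ratio (𝓝[>] 0) atTop := by
  have h : Tendsto (fun δ : ℝ => c.v / c.vb * δ⁻¹) (𝓝[>] 0) atTop :=
    tendsto_inv_nhdsGT_zero.const_mul_atTop (div_pos c.v_pos c.vb_pos)
  refine h.congr fun δ => ?_
  rw [ratio, div_mul_eq_div_div]; rfl

/-- The order of choices matters: `ε₀` depends only on the chain, through `Low` and the sign of `sin
((Y₁ - Y₂) ω)`. Only then is `δ` taken small, so that the ratio is large enough at the fixed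
frequency `ε`. -/
theorem exists_window : ∃ ε₀ > 0, ∀ ε ∈ Set.Ioc 0 ε₀, ∀ᶠ δ in 𝓝[>] (0 : ℝ), c.Window δ ε := by
  have p1 := c.v_pos
  have p2 := c.vb_pos
  have p3 := c.ℓ₁_pos
  have p4 := c.s₁_pos
  have p5 := c.s₂_pos
  have hX : 0 < c.ℓ₁ / c.vb := by positivity
  have h₁ : 0 < c.s₁ / (2 * c.v) := by positivity
  have h₂ : 0 < c.s₂ / (2 * c.v) := by positivity
  have hd : c.s₂ < c.s₁ → ∀ᶠ ω in 𝓝[>] (0 : ℝ),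
      0 < Real.sin ((c.s₁ / (2 * c.v) - c.s₂ / (2 * c.v)) * ω) := fun h =>
    eventually_sin_pos (by rw [← sub_div]; exact div_pos (by linarith) (by linarith))
  have hd' : c.s₁ < c.s₂ → ∀ᶠ ω in 𝓝[>] (0 : ℝ),
      0 < Real.sin ((c.s₂ / (2 * c.v) - c.s₁ / (2 * c.v)) * ω) := fun h =>
    eventually_sin_pos (by rw [← sub_div]; exact div_pos (by linarith) (by linarith))
  obtain ⟨ε₀, hε₀, hlow⟩ := mem_nhdsGT_iff_exists_Ioc_subset.1
    (((eventually_low hX h₁ h₂).and (eventually_imp_distrib_left.2 hd)).and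
      (eventually_imp_distrib_left.2 hd'))
  refine ⟨ε₀, hε₀, fun ε hε => ?_⟩
  have hl : ∀ ω ∈ Set.Ioc 0 ε, Low (c.ℓ₁ / c.vb) (c.s₁ / (2 * c.v)) (c.s₂ / (2 * c.v)) ω :=
    fun ω hω => (hlow ⟨hω.1, hω.2.trans hε.2⟩).1.1
  have hls : ∀ ω ∈ Set.Ioc 0 ε, c.s₂ < c.s₁ →
      0 < Real.sin ((c.s₁ / (2 * c.v) - c.s₂ / (2 * c.v)) * ω) :=
    fun ω hω => (hlow ⟨hω.1, hω.2.trans hε.2⟩).1.2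
  have hls' : ∀ ω ∈ Set.Ioc 0 ε, c.s₁ < c.s₂ →
      0 < Real.sin ((c.s₂ / (2 * c.v) - c.s₁ / (2 * c.v)) * ω) :=
    fun ω hω => (hlow ⟨hω.1, hω.2.trans hε.2⟩).2
  have hε' := hl ε ⟨hε.1, le_rfl⟩
  have hA := c.tendsto_ratio.atTop_mul_const
    (mul_pos hε'.sinX (mul_pos hε'.sin₂ hε'.cos₁)) |>.eventually_gt_atTop 2
  have hD := c.tendsto_ratio.atTop_mul_const
    (mul_pos hε'.sinX (mul_pos hε'.sin₁ hε'.cos₂)) |>.eventually_gt_atTop 2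
  filter_upwards [hA, hD, c.tendsto_ratio.eventually_gt_atTop 1, self_mem_nhdsWithin]
    with δ hA hD hr hδ
  have hδ : 0 < δ := hδ
  have hr0 : 0 < c.ratio δ := by linarith
  have hr' : (c.ratio δ)⁻¹ < c.ratio δ := (inv_lt_one_of_one_lt₀ hr).trans hr
  have hri := inv_pos.2 hr0
  refine ⟨hδ, hε.1, by simp [tA, entry], by simp [tD, entry], by simp [tC], ?_,
    entry_lt_neg_one hr0 hε' hA, entry_lt_neg_one hr0 hε'.symm hD,
    fun ω hω => hasDerivAt_entry hr0 hX h₁ h₂ (hl ω hω),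
    fun ω hω => hasDerivAt_entry hr0 hX h₂ h₁ (hl ω hω).symm, fun h ω hω => ?_, fun h ω hω => ?_,
    fun ω hω => ?_⟩
  · simp only [tB, zero_div, zero_mul, Real.cos_zero, sn_zero_left]
    simp
    positivity
  · have := mul_pos (sub_pos.2 hr') (mul_pos (hl ω hω).sinX (hls ω hω h))
    rw [← entry_sub_entry] at this
    exact sub_pos.1 this
  · have := mul_pos (sub_pos.2 hr') (mul_pos (hl ω hω).sinX (hls' ω hω h))
    rw [← entry_sub_entry] at this
    exact sub_pos.1 this
  · obtain ⟨a1, a2, a3, a4, a5, a6, a7, a8, a9⟩ := hl ω hω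
    have h0 := hω.1
    have b1 : 0 < δ * ω / c.v := by positivity
    have b2 : 0 < Real.sin ((c.s₁ / (2 * c.v) + c.s₂ / (2 * c.v)) * ω) := by
      rw [add_mul, Real.sin_add]; positivity
    rw [add_mul, Real.cos_add] at a7
    have b3 : (c.ratio δ)⁻¹ * (Real.sin (c.s₁ / (2 * c.v) * ω) * Real.sin (c.s₂ / (2 * c.v) * ω)) <
        c.ratio δ * (Real.cos (c.s₁ / (2 * c.v) * ω) * Real.cos (c.s₂ / (2 * c.v) * ω)) :=
      mul_lt_mul'' hr' (by linarith) hri.le (by positivity)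
    have b4 := mul_pos a1 (sub_pos.2 b3)
    exact neg_neg_of_pos (mul_pos b1 (add_pos (mul_pos a2 b2) b4))

end

section
variable {c : DimerChain} {δ ε : ℝ}

theorem continuous_tA (c : DimerChain) (δ : ℝ) : Continuous (c.tA δ) := continuous_entry ..
theorem continuous_tD (c : DimerChain) (δ : ℝ) : Continuous (c.tD δ) := continuous_entry ..

theorem strictAntiOn_of_hasDerivAt_neg {f : ℝ → ℝ} (hf : Continuous f)
    (h : ∀ ω ∈ Set.Ioc 0 ε, ∃ a' < 0, HasDerivAt f a' ω) : StrictAntiOn f (Set.Icc 0 ε) := by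
  refine strictAntiOn_of_deriv_neg (convex_Icc 0 ε) hf.continuousOn fun ω hω => ?_
  rw [interior_Icc] at hω
  obtain ⟨a', ha, hd⟩ := h ω ⟨hω.1, hω.2.le⟩
  rwa [hd.deriv]

theorem Window.a_anti (h : c.Window δ ε) : StrictAntiOn (c.tA δ) (Set.Icc 0 ε) :=
  strictAntiOn_of_hasDerivAt_neg (c.continuous_tA δ) h.a_deriv

theorem Window.d_anti (h : c.Window δ ε) : StrictAntiOn (c.tD δ) (Set.Icc 0 ε) :=
  strictAntiOn_of_hasDerivAt_neg (c.continuous_tD δ) h.d_deriv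

/-- At the point `m` where the smaller of `f`, `g` reaches zero the product is `0`. Up to `m` both
functions are nonnegative, and the product attains every value between `0` and `f 0 * g 0 ≥ 1`. -/
theorem exists_mul_eq {f g : ℝ → ℝ} {τ : ℝ} (hε : 0 ≤ ε) (hf : StrictAntiOn f (Set.Icc 0 ε))
    (hg : StrictAntiOn g (Set.Icc 0 ε)) (cf : Continuous f) (cg : Continuous g) (f0 : 1 ≤ f 0)
    (g0 : 1 ≤ g 0) (f1 : f ε ≤ 0) (hτ : τ ∈ Set.Icc 0 1) :
    ∃ ω ∈ Set.Icc 0 ε, 0 ≤ f ω ∧ 0 ≤ g ω ∧ f ω * g ω = τ := by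
  obtain ⟨m, hm, hm0⟩ := intermediate_value_Icc' hε (f := fun ω => min (f ω) (g ω))
    (by fun_prop) (show (0 : ℝ) ∈ _ from ⟨min_le_of_left_le f1, le_min (by linarith) (by linarith)⟩)
  have hm0 : min (f m) (g m) = 0 := hm0
  have hfm : 0 ≤ f m := hm0 ▸ min_le_left _ _
  have hgm : 0 ≤ g m := hm0 ▸ min_le_right _ _
  have hfg : f m * g m = 0 := by
    rcases min_choice (f m) (g m) with h | h <;> rw [h] at hm0 <;> simp [hm0]
  obtain ⟨ω, hω, h⟩ := intermediate_value_Icc' hm.1 (f := fun ω => f ω * g ω)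
    (by fun_prop) (show τ ∈ _ from ⟨by simpa only [hfg] using hτ.1,
      hτ.2.trans (one_le_mul_of_one_le_of_one_le f0 g0)⟩)
  have hω' : ω ∈ Set.Icc 0 ε := ⟨hω.1, hω.2.trans hm.2⟩
  exact ⟨ω, hω', hfm.trans (hf.antitoneOn hω' hm hω.2), hgm.trans (hg.antitoneOn hω' hm hω.2), h⟩

theorem eq_of_mul_eq {f g : ℝ → ℝ} {u v : ℝ} (hf : StrictAntiOn f (Set.Icc 0 ε))
    (hg : StrictAntiOn g (Set.Icc 0 ε)) (hu : u ∈ Set.Icc 0 ε) (hv : v ∈ Set.Icc 0 ε)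
    (fu : 0 ≤ f u) (gu : 0 ≤ g u) (fv : 0 ≤ f v) (gv : 0 ≤ g v)
    (h : f u * g u = f v * g v) : u = v := by
  rcases lt_trichotomy u v with huv | huv | huv
  · exact absurd h (mul_lt_mul'' (hf hu hv huv) (hg hu hv huv) fv gv).ne'
  · exact huv
  · exact absurd h (mul_lt_mul'' (hf hv hu huv) (hg hv hu huv) fu gu).ne

theorem eq_of_mul_eq' {f g : ℝ → ℝ} {u v : ℝ} (hf : StrictAntiOn f (Set.Icc 0 ε))
    (hg : StrictAntiOn g (Set.Icc 0 ε)) (hu : u ∈ Set.Icc 0 ε) (hv : v ∈ Set.Icc 0 ε)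
    (fu : f u ≤ 0) (gu : g u ≤ 0) (fv : f v ≤ 0) (gv : g v ≤ 0)
    (h : f u * g u = f v * g v) : u = v := by
  rw [← neg_mul_neg, ← neg_mul_neg (f v)] at h
  rcases lt_trichotomy u v with huv | huv | huv
  · exact absurd h (mul_lt_mul'' (neg_lt_neg (hf hu hv huv)) (neg_lt_neg (hg hu hv huv))
      (neg_nonneg.2 fu) (neg_nonneg.2 gu)).ne
  · exact huv
  · exact absurd h (mul_lt_mul'' (neg_lt_neg (hf hv hu huv)) (neg_lt_neg (hg hv hu huv))
      (neg_nonneg.2 fv) (neg_nonneg.2 gv)).ne'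

variable (c δ ε) in
/-- `ω` lies on the lower (`σ = 1`) or upper (`σ = -1`) band at the quasiperiodicity `α`. -/
def OnBand (σ α ω : ℝ) : Prop :=
  ω ∈ Set.Icc 0 ε ∧ 0 ≤ σ * c.tA δ ω ∧ 0 ≤ σ * c.tD δ ω ∧
    c.tA δ ω * c.tD δ ω = Real.cos (α * c.L / 2) ^ 2

theorem isClosed_onBand (c : DimerChain) (δ ε σ : ℝ) :
    IsClosed {p : ℝ × ℝ | c.OnBand δ ε σ p.1 p.2} := by
  have h1 := c.continuous_tA δ
  have h2 := c.continuous_tD δ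
  have : {p : ℝ × ℝ | c.OnBand δ ε σ p.1 p.2} = {p | p.2 ∈ Set.Icc 0 ε} ∩ ({p | 0 ≤ σ * c.tA δ p.2}
      ∩ ({p | 0 ≤ σ * c.tD δ p.2} ∩
        {p | c.tA δ p.2 * c.tD δ p.2 = Real.cos (p.1 * c.L / 2) ^ 2})) := rfl
  rw [this]
  exact (isClosed_Icc.preimage continuous_snd).inter ((isClosed_le (by fun_prop) (by fun_prop)).inter
    ((isClosed_le (by fun_prop) (by fun_prop)).inter (isClosed_eq (by fun_prop) (by fun_prop))))

/-- A function into a compact set that is determined by a closed relation is continuous. -/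
theorem continuous_of_isClosed_graph {R : ℝ → ℝ → Prop} (hR : IsClosed {p : ℝ × ℝ | R p.1 p.2})
    {K : Set ℝ} (hK : IsCompact K) (hu : ∀ α u v, R α u → R α v → u = v) {f : ℝ → ℝ}
    (hf : ∀ α, R α (f α)) (hfK : ∀ α, f α ∈ K) : Continuous f := by
  refine continuous_iff_ultrafilter.2 fun α g hg => ?_
  obtain ⟨u, -, hu'⟩ := hK.ultrafilter_le_nhds (g.map f)
    (le_principal_iff.2 (Filter.univ_mem' hfK : f ⁻¹' K ∈ (g : Filter ℝ)))
  have : (α, u) ∈ {p : ℝ × ℝ | R p.1 p.2} := by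
    refine hR.mem_of_tendsto (b := (g : Filter ℝ)) (f := fun β => (β, f β)) ?_
      (Eventually.of_forall hf)
    exact Tendsto.prodMk_nhds (tendsto_id'.2 hg) hu'
  rw [hu α _ _ (hf α) this]
  exact hu'

theorem OnBand.unique {σ : ℝ} (hσ : σ = 1 ∨ σ = -1) (h : c.Window δ ε) {α u v : ℝ}
    (hu : c.OnBand δ ε σ α u) (hv : c.OnBand δ ε σ α v) : u = v := by
  obtain ⟨u1, u2, u3, u4⟩ := hu
  obtain ⟨v1, v2, v3, v4⟩ := hv
  have e := u4.trans v4.symm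
  rcases hσ with rfl | rfl
  · simp only [one_mul] at *
    exact eq_of_mul_eq h.a_anti h.d_anti u1 v1 u2 u3 v2 v3 e
  · simp only [neg_one_mul, Left.nonneg_neg_iff] at *
    exact eq_of_mul_eq' h.a_anti h.d_anti u1 v1 u2 u3 v2 v3 e

theorem cos_sq_mem (x : ℝ) : Real.cos x ^ 2 ∈ Set.Icc (0 : ℝ) 1 :=
  ⟨sq_nonneg _, Real.cos_sq_le_one x⟩

theorem exists_onBand {σ : ℝ} (hσ : σ = 1 ∨ σ = -1) (h : c.Window δ ε) (α : ℝ) :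
    ∃ ω, c.OnBand δ ε σ α ω := by
  have ca := c.continuous_tA δ
  have cd := c.continuous_tD δ
  rcases hσ with rfl | rfl
  · obtain ⟨ω, h1, h2, h3, h4⟩ := exists_mul_eq h.ε_pos.le h.a_anti h.d_anti ca cd h.a_zero.ge
      h.d_zero.ge (by linarith [h.a_end]) (cos_sq_mem (α * c.L / 2))
    exact ⟨ω, h1, by simpa, by simpa, h4⟩
  -- The upper branch becomes the lower one under `ω ↦ ε - ω` and a change of sign; the values below
  -- `-1` at `ε` now play the role of the initial values.
  · have hr : ∀ {u : ℝ}, u ∈ Set.Icc 0 ε → ε - u ∈ Set.Icc 0 ε := fun hu =>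
      ⟨by linarith [hu.2], by linarith [hu.1]⟩
    obtain ⟨ω, h1, h2, h3, h4⟩ := exists_mul_eq (f := fun ω => -c.tA δ (ε - ω))
      (g := fun ω => -c.tD δ (ε - ω)) h.ε_pos.le
      (fun u hu v hv huv => neg_lt_neg (h.a_anti (hr hv) (hr hu) (by linarith)))
      (fun u hu v hv huv => neg_lt_neg (h.d_anti (hr hv) (hr hu) (by linarith)))
      (by fun_prop) (by fun_prop) (by simpa using by linarith [h.a_end])
      (by simpa using by linarith [h.d_end])
      (by simp [h.a_zero]) (cos_sq_mem (α * c.L / 2))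
    exact ⟨ε - ω, hr h1, by simpa using h2, by simpa using h3, by simpa using h4⟩

theorem Window.a_ne_d (hs : c.s₁ ≠ c.s₂) (h : c.Window δ ε) {ω : ℝ} (hω : ω ∈ Set.Ioc 0 ε) :
    c.tA δ ω ≠ c.tD δ ω := by
  rcases lt_or_gt_of_ne hs with hs | hs
  · exact (h.a_lt_d hs ω hω).ne
  · exact (h.d_lt_a hs ω hω).ne'

/-- If `v ≤ u`, monotonicity gives `0 ≤ tA u ≤ tA v ≤ 0`, and likewise for `tD`, so both vanish at
`v > 0` and coincide there. The quasiperiodicities may differ, so this is a genuine band gap. -/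
theorem OnBand.lt (hs : c.s₁ ≠ c.s₂) (h : c.Window δ ε) {α β u v : ℝ}
    (hu : c.OnBand δ ε 1 α u) (hv : c.OnBand δ ε (-1) β v) : u < v := by
  obtain ⟨u1, u2, u3, -⟩ := hu
  obtain ⟨v1, v2, v3, -⟩ := hv
  simp only [one_mul, neg_one_mul, Left.nonneg_neg_iff] at *
  by_contra! hvu
  have ha := h.a_anti.antitoneOn v1 u1 hvu
  have hd := h.d_anti.antitoneOn v1 u1 hvu
  have hv0 : 0 < v := by
    refine lt_of_le_of_ne v1.1 fun h0 => ?_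
    rw [← h0, h.a_zero] at v2
    linarith
  exact h.a_ne_d hs ⟨hv0, v1.2⟩ (by linarith)

theorem onBand_or {α ω : ℝ} (hω : ω ∈ Set.Icc 0 ε)
    (e : c.tA δ ω * c.tD δ ω = Real.cos (α * c.L / 2) ^ 2) :
    c.OnBand δ ε 1 α ω ∨ c.OnBand δ ε (-1) α ω := by
  unfold OnBand
  simp only [one_mul, neg_one_mul, Left.nonneg_neg_iff]
  rcases mul_nonneg_iff.1 (e ▸ sq_nonneg (Real.cos (α * c.L / 2)) :
    0 ≤ c.tA δ ω * c.tD δ ω) with h' | h'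
  · exact Or.inl ⟨hω, h'.1, h'.2, e⟩
  · exact Or.inr ⟨hω, h'.1, h'.2, e⟩

/-- Resonances are the frequencies that satisfy the dispersion relation. -/
theorem mul_eq_of_mem_resonances (hℓ : c.ℓ₁ = c.ℓ₂) (hδ : 0 < δ) {α ω : ℝ}
    (h : ω ∈ c.resonances δ α) : c.tA δ ω * c.tD δ ω = Real.cos (α * c.L / 2) ^ 2 := by
  obtain ⟨-, ψ, hψ0, hψ⟩ := h
  obtain ⟨y, z, hyz, hc⟩ := hψ.exists_closes hℓ hδ
  rw [c.closes_iff hδ] at hyz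
  by_contra hne
  apply hψ0
  have h1 : ((Real.cos (α * c.L / 2) : ℝ) : ℂ) ^ 2 + (Real.sin (α * c.L / 2) : ℝ) ^ 2 = 1 := by
    exact_mod_cast Real.cos_sq_add_sin_sq _
  have h2 : (c.tA δ ω * c.tD δ ω - c.tB δ ω * c.tC δ ω : ℂ) = 1 := by
    exact_mod_cast c.det_transfer hδ ω
  have h3 : (c.tA δ ω * c.tD δ ω - (Real.cos (α * c.L / 2) : ℝ) ^ 2 : ℂ) ≠ 0 := by
    rw [sub_ne_zero]; exact_mod_cast hne
  obtain ⟨e1, e2⟩ := hyz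
  generalize ((Real.cos (α * c.L / 2) : ℝ) : ℂ) = t at *
  generalize ((Real.sin (α * c.L / 2) : ℝ) : ℂ) = s at *
  have hI := Complex.I_sq
  -- Up to sign, the factor is the determinant of the linear system for `(y, z)`; the two
  -- combinations below are Cramer's rule.
  have k : ∀ w : ℂ, (c.tA δ ω * c.tD δ ω - t ^ 2 : ℂ) * w = 0 → w = 0 := fun w hw =>
    (mul_eq_zero.1 hw).resolve_left h3
  have hy : y = 0 := k y (by
    linear_combination c.tB δ ω * t * e2 + Complex.I * s * c.tD δ ω * e1
      + s ^ 2 * c.tA δ ω * c.tD δ ω * y * hI - y * c.tA δ ω * c.tD δ ω * h1 + y * t ^ 2 * h2)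
  have hz : z = 0 := k z (by
    linear_combination c.tC δ ω * t * e1 + Complex.I * s * c.tA δ ω * e2
      + s ^ 2 * c.tA δ ω * c.tD δ ω * z * hI - z * c.tA δ ω * c.tD δ ω * h1 + z * t ^ 2 * h2)
  refine hψ.eq_of_eqOn α (by simp) fun x hx => ?_
  rw [hc x hx, hy, hz, cell_zero]; rfl

/-- Real solutions `(A, B)` of the mode equations give the state `(A, i B)`. -/
def RealMode (c : DimerChain) (δ α ω A B : ℝ) : Prop :=
  c.tB δ ω * Real.cos (α * c.L / 2) * B = Real.sin (α * c.L / 2) * c.tA δ ω * A ∧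
    c.tC δ ω * Real.cos (α * c.L / 2) * A = -(Real.sin (α * c.L / 2) * c.tD δ ω * B)

theorem RealMode.closes (hδ : 0 < δ) {α ω A B : ℝ} (h : c.RealMode δ α ω A B) :
    c.Closes δ ω (Complex.exp (Complex.I * α * c.L)) A (Complex.I * B) := by
  rw [c.closes_iff hδ]
  obtain ⟨h1, h2⟩ := h
  have e1 : (c.tB δ ω * Real.cos (α * c.L / 2) * B : ℂ) = Real.sin (α * c.L / 2) * c.tA δ ω * A := by
    exact_mod_cast h1
  have e2 : (c.tC δ ω * Real.cos (α * c.L / 2) * A : ℂ)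
      = -(Real.sin (α * c.L / 2) * c.tD δ ω * B) := by
    exact_mod_cast h2
  constructor
  · linear_combination Complex.I * e1
  · linear_combination e2 - Real.sin (α * c.L / 2) * c.tD δ ω * B * Complex.I_sq

end

end DimerChain
-- Existence and uniqueness of modes, and classification of the bands
namespace DimerChain

section
variable {c : DimerChain} {δ ε : ℝ}

theorem D_subset_Ico (hℓ : c.ℓ₁ = c.ℓ₂) : c.D ⊆ Set.Ico 0 c.L := by
  have p1 := c.ℓ₁_pos
  have p2 := c.s₁_pos
  have p3 := c.s₂_pos
  have hL : c.L = c.ℓ₁ + c.s₁ + c.ℓ₁ + c.s₂ := by unfold L; rw [← hℓ]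
  rintro x (hx | hx)
  · exact ⟨hx.1.le, by linarith [hx.2]⟩
  · rw [← hℓ] at hx
    exact ⟨by linarith [hx.1], by linarith [hx.2]⟩

/-- By the dispersion relation the real two by two system is singular. A nonzero row, rotated by a
right angle, gives a kernel vector; if both rows vanish, any vector will do. -/
theorem exists_realMode (hδ : 0 < δ) {α ω : ℝ}
    (h : c.tA δ ω * c.tD δ ω = Real.cos (α * c.L / 2) ^ 2) :
    ∃ A B : ℝ, (A ≠ 0 ∨ B ≠ 0) ∧ c.RealMode δ α ω A B := by
  have hdet := c.det_transfer hδ ω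
  have h1 := Real.cos_sq_add_sin_sq (α * c.L / 2)
  unfold RealMode
  generalize Real.cos (α * c.L / 2) = t at *
  generalize Real.sin (α * c.L / 2) = s at *
  generalize c.tA δ ω = a at *
  generalize c.tB δ ω = b at *
  generalize c.tC δ ω = g at *
  generalize c.tD δ ω = d at *
  have key : t ^ 2 * (b * g) + s ^ 2 * (a * d) = 0 := by
    linear_combination a * d * h1 - t ^ 2 * hdet + h
  by_cases h2 : b * t = 0 ∧ s * a = 0
  · by_cases h3 : s * d = 0 ∧ g * t = 0
    · exact ⟨1, 0, by simp, by rw [h2.2]; ring, by rw [h3.2]; ring⟩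
    · refine ⟨s * d, -(g * t), ?_, ?_, by ring⟩
      · rw [neg_ne_zero]; tauto
      · linear_combination -key
  · exact ⟨b * t, s * a, by tauto, by ring, by linear_combination key⟩

theorem OnBand.mem_resonances (hℓ : c.ℓ₁ = c.ℓ₂) (hδ : 0 < δ) {σ α ω : ℝ}
    (h : c.OnBand δ ε σ α ω) : ω ∈ c.resonances δ α := by
  obtain ⟨A, B, hAB, hm⟩ := exists_realMode hδ h.2.2.2
  obtain ⟨ψ, hψ, hc⟩ := (hm.closes hδ).exists_isMode hℓ hδ
  refine ⟨h.1.1, ψ, ?_, hψ⟩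
  rintro rfl
  have := eq_zero_of_cell_eq_zero hℓ hδ fun x hx => (hc x (D_subset_Ico hℓ hx)).symm
  simp at this
  tauto

/-- Two independent states would make all four coefficients of the mode equations vanish. At `ω = 0`
this contradicts `tA = 1` and `tB > 0`. For `ω > 0`, `tC < 0` forces `cos (αL/2) = 0`, and then `tA
= tD = 0`, which unequal gaps exclude. -/
theorem OnBand.isNondegenerate (hℓ : c.ℓ₁ = c.ℓ₂) (hs : c.s₁ ≠ c.s₂) (h : c.Window δ ε) {σ : ℝ}
    {ω : ℝ → ℝ} (hω : ∀ α, c.OnBand δ ε σ α (ω α)) : c.IsNondegenerate δ ω := by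
  intro α ψ φ hψ hφ hψ0
  obtain ⟨y₁, z₁, hc₁, h₁⟩ := hψ.exists_closes hℓ h.δ_pos
  obtain ⟨y₂, z₂, hc₂, h₂⟩ := hφ.exists_closes hℓ h.δ_pos
  rw [c.closes_iff h.δ_pos] at hc₁ hc₂
  obtain ⟨hm, -, -, hmul⟩ := hω α
  have hne : y₁ ≠ 0 ∨ z₁ ≠ 0 := by
    by_contra! h0
    apply hψ0
    refine hψ.eq_of_eqOn α (by simp) fun x hx => ?_
    rw [h₁ x hx, h0.1, h0.2, cell_zero]; rfl
  have hcross : y₁ * z₂ = y₂ * z₁ := by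
    by_contra hX
    have hX : y₁ * z₂ - y₂ * z₁ ≠ 0 := sub_ne_zero.2 hX
    have k : ∀ r : ℝ, (r : ℂ) * (y₁ * z₂ - y₂ * z₁) = 0 → r = 0 := fun r hr => by
      exact_mod_cast (mul_eq_zero.1 hr).resolve_right hX
    have k1 : c.tB δ (ω α) * Real.cos (α * c.L / 2) = 0 := k _ (by
      push_cast [-Complex.ofReal_cos]
      linear_combination y₁ * hc₂.1 - y₂ * hc₁.1)
    have k2 : c.tC δ (ω α) * Real.cos (α * c.L / 2) = 0 := k _ (by
      push_cast [-Complex.ofReal_cos]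
      linear_combination z₂ * hc₁.2 - z₁ * hc₂.2)
    have k3 : Real.sin (α * c.L / 2) * c.tA δ (ω α) = 0 := k _ (by
      push_cast [-Complex.ofReal_sin]
      linear_combination Complex.I * (z₂ * hc₁.1 - z₁ * hc₂.1) +
        (Real.sin (α * c.L / 2) * c.tA δ (ω α)) * (y₁ * z₂ - y₂ * z₁) * Complex.I_sq)
    have k4 : Real.sin (α * c.L / 2) * c.tD δ (ω α) = 0 := k _ (by
      push_cast [-Complex.ofReal_sin]
      linear_combination Complex.I * (y₁ * hc₂.2 - y₂ * hc₁.2) +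
        (Real.sin (α * c.L / 2) * c.tD δ (ω α)) * (y₁ * z₂ - y₂ * z₁) * Complex.I_sq)
    have h1 := Real.cos_sq_add_sin_sq (α * c.L / 2)
    rcases hm.1.eq_or_lt with h0 | h0
    · rw [← h0] at k1 k3
      rw [h.a_zero, mul_one] at k3
      rw [k3, (mul_eq_zero.1 k1).resolve_left h.b_zero.ne'] at h1
      norm_num at h1
    · have hc := (mul_eq_zero.1 k2).resolve_left (h.c_neg _ ⟨h0, hm.2⟩).ne
      rw [hc] at h1
      have hs0 : Real.sin (α * c.L / 2) ≠ 0 := by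
        intro h3; rw [h3] at h1; norm_num at h1
      exact h.a_ne_d hs ⟨h0, hm.2⟩ (((mul_eq_zero.1 k3).resolve_left hs0).trans
        ((mul_eq_zero.1 k4).resolve_left hs0).symm)
  obtain ⟨a, ha1, ha2⟩ : ∃ a : ℂ, y₂ = a * y₁ ∧ z₂ = a * z₁ := by
    by_cases hy : y₁ = 0
    · have hz := hne.resolve_left (not_not.2 hy)
      refine ⟨z₂ / z₁, ?_, by field_simp⟩
      rw [hy, zero_mul] at hcross
      rw [hy, mul_zero]
      exact (mul_eq_zero.1 hcross.symm).resolve_right hz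
    · refine ⟨y₂ / y₁, by field_simp, ?_⟩
      field_simp
      linear_combination hcross
  refine ⟨a, hφ.eq_of_eqOn α (fun x => ?_) fun x hx => ?_⟩
  · simp only [Pi.smul_apply, smul_eq_mul, hψ.2.1 x]; ring
  · rw [h₂ x hx, ha1, ha2, cell_smul, Pi.smul_apply, smul_eq_mul, h₁ x hx]

end

/-- The lower (`σ = 1`) or upper (`σ = -1`) subwavelength band. -/
noncomputable def band (c : DimerChain) (ε σ δ α : ℝ) : ℝ :=
  -- The default `0` is never taken when a `Window` is available.
  open Classical in if h : ∃ ω, c.OnBand δ ε σ α ω then h.choose else 0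

section
variable {c : DimerChain} {δ ε σ : ℝ}

theorem onBand_band (hσ : σ = 1 ∨ σ = -1) (h : c.Window δ ε) (α : ℝ) :
    c.OnBand δ ε σ α (c.band ε σ δ α) := by
  have := exists_onBand hσ h α
  rw [band, dif_pos this]
  exact this.choose_spec

theorem half_period (c : DimerChain) (α : ℝ) :
    (α + 2 * Real.pi / c.L) * c.L / 2 = α * c.L / 2 + Real.pi := by
  have := c.L_pos.ne'
  field_simp

theorem OnBand.add_period {α ω : ℝ} (h : c.OnBand δ ε σ α ω) :
    c.OnBand δ ε σ (α + 2 * Real.pi / c.L) ω := by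
  obtain ⟨h1, h2, h3, h4⟩ := h
  exact ⟨h1, h2, h3, by rw [half_period, Real.cos_add_pi, neg_sq, h4]⟩

theorem OnBand.continuous (hσ : σ = 1 ∨ σ = -1) (h : c.Window δ ε) {ω : ℝ → ℝ}
    (hω : ∀ α, c.OnBand δ ε σ α (ω α)) : Continuous ω :=
  continuous_of_isClosed_graph (c.isClosed_onBand δ ε σ) isCompact_Icc
    (fun _ _ _ hu hv => hu.unique hσ h hv) hω fun α => (hω α).1

theorem isSubwavelengthBand_band (hℓ : c.ℓ₁ = c.ℓ₂) (hσ : σ = 1 ∨ σ = -1) (hε : 0 < ε)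
    (h : ∀ ε' ∈ Set.Ioc 0 ε, ∀ᶠ δ in 𝓝[>] (0 : ℝ), c.Window δ ε') :
    c.IsSubwavelengthBand (c.band ε σ) := by
  have h0 := h ε ⟨hε, le_rfl⟩
  constructor
  · filter_upwards [h0] with δ hw
    have hb := onBand_band hσ hw
    exact ⟨OnBand.continuous hσ hw hb, fun α => (hb _).unique hσ hw (hb α).add_period,
      fun α => (hb α).mem_resonances hℓ hw.δ_pos⟩
  · intro α
    refine tendsto_order.2 ⟨fun u hu => ?_, fun u hu => ?_⟩
    · filter_upwards [h0] with δ hw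
      exact hu.trans_le (onBand_band hσ hw α).1.1
    · have hm : min ε (u / 2) ∈ Set.Ioc 0 ε := ⟨lt_min hε (by linarith), min_le_left _ _⟩
      filter_upwards [h0, h _ hm] with δ hw hw'
      obtain ⟨ω, h1, h2⟩ := exists_onBand hσ hw' α
      have : c.OnBand δ ε σ α ω := ⟨⟨h1.1, h1.2.trans hm.2⟩, h2⟩
      rw [(onBand_band hσ hw α).unique hσ hw this]
      linarith [h1.2.trans (min_le_right _ _)]

/-- A continuous family of low-frequency resonances follows one of the two bands. -/
theorem Window.onBand_or_onBand (hℓ : c.ℓ₁ = c.ℓ₂) (hs : c.s₁ ≠ c.s₂) (h : c.Window δ ε)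
    {ω : ℝ → ℝ} (hω : Continuous ω) (hr : ∀ α, ω α ∈ c.resonances δ α) (h0 : ω 0 < ε) :
    (∀ α, c.OnBand δ ε 1 α (ω α)) ∨ ∀ α, c.OnBand δ ε (-1) α (ω α) := by
  have he := fun α => mul_eq_of_mem_resonances hℓ h.δ_pos (hr α)
  -- A continuous family starting below `ε` would have to take the value `ε`, where `tA * tD > 1`
  -- exceeds any squared cosine.
  have hlt : ∀ α, ω α < ε := by
    by_contra! ⟨α, hα⟩
    obtain ⟨β, hβ⟩ := mem_range_of_exists_le_of_exists_ge hω ⟨0, h0.le⟩ ⟨α, hα⟩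
    have := he β
    rw [hβ] at this
    have h1 := Real.cos_sq_le_one (β * c.L / 2)
    nlinarith [h.a_end, h.d_end]
  have hor := fun α => onBand_or ⟨(hr α).1, (hlt α).le⟩ (he α)
  have hcl (σ : ℝ) : IsClosed {α | c.OnBand δ ε σ α (ω α)} :=
    (c.isClosed_onBand δ ε σ).preimage (f := fun α => (α, ω α)) (by fun_prop)
  have hcompl : {α | c.OnBand δ ε 1 α (ω α)}ᶜ = {α | c.OnBand δ ε (-1) α (ω α)} := by
    ext α
    exact ⟨(hor α).resolve_left, fun h2 h1 => (h1.lt hs h h2).false⟩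
  have hclopen : IsClopen {α | c.OnBand δ ε 1 α (ω α)} :=
    ⟨hcl 1, by rw [← isClosed_compl_iff, hcompl]; exact hcl _⟩
  rcases isClopen_iff.1 hclopen with h1 | h1
  · right
    rw [h1, Set.compl_empty] at hcompl
    exact fun α => Set.eq_univ_iff_forall.1 hcompl.symm α
  · left
    exact fun α => Set.eq_univ_iff_forall.1 h1 α

/-- The limit is needed at `α = 0` only: continuity in `α` then confines the whole band to the
window. -/
theorem IsSubwavelengthBand.eventually_onBand (hℓ : c.ℓ₁ = c.ℓ₂) (hs : c.s₁ ≠ c.s₂) (hε : 0 < ε)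
    (h : ∀ᶠ δ in 𝓝[>] (0 : ℝ), c.Window δ ε) {ω : ℝ → ℝ → ℝ} (hω : c.IsSubwavelengthBand ω) :
    ∀ᶠ δ in 𝓝[>] (0 : ℝ), c.Window δ ε ∧
      ((∀ α, c.OnBand δ ε 1 α (ω δ α)) ∨ ∀ α, c.OnBand δ ε (-1) α (ω δ α)) := by
  filter_upwards [h, hω.1, (hω.2 0).eventually_lt_const hε] with δ hw h1 h2
  exact ⟨hw, hw.onBand_or_onBand hℓ hs h1.1 h1.2.2 h2⟩

end

end DimerChain
-- Phases of families spanned by a real frame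
namespace DimerChain

/-- A continuous function into the unit circle lifts to a continuous angle, and the integral of its
logarithmic derivative is the change of the angle. -/
theorem exists_angle {f : ℝ → ℂ} (hf : Continuous f) (h1 : ∀ x, ‖f x‖ = 1) {S : Set ℝ}
    (hS : S.Countable) (hd : ∀ x ∉ S, DifferentiableAt ℝ f x) {a b : ℝ} (hab : a ≤ b)
    (hi : IntervalIntegrable (fun x => deriv f x / f x) volume a b) :
    ∃ g : ℝ → ℝ, (∀ x, f x = Complex.exp (g x * Complex.I)) ∧
      ∫ x in a..b, deriv f x / f x = (g b - g a) * Complex.I := by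
  have hne : ∀ x, f x ≠ 0 := fun x h => by simpa [h] using h1 x
  let F : C(ℝ, Circle) := ⟨fun x => ⟨f x, by simp [Submonoid.unitSphere, h1]⟩, by fun_prop⟩
  obtain ⟨t, ht⟩ : ∃ t, Circle.exp t = F 0 := ⟨_, Circle.exp_arg (F 0)⟩
  obtain ⟨g, ⟨-, hg⟩, -⟩ := Circle.isCoveringMap_exp.existsUnique_continuousMap_lifts F 0 t ht
  have hfg : ∀ x, f x = Complex.exp (g x * Complex.I) := fun x => by
    have := congrArg (fun z : Circle => (z : ℂ)) (congrFun hg x)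
    rw [← Circle.coe_exp]
    exact this.symm
  have hgd : ∀ x ∉ S, HasDerivAt (fun x => (g x : ℂ) * Complex.I) (deriv f x / f x) x := by
    intro x hx
    -- Near `x` the angle moves by less than `π`, so the principal logarithm recovers its increment,
    -- and `g` inherits differentiability from `f`.
    have hev : (fun y => (g y : ℂ) * Complex.I) =ᶠ[𝓝 x]
        fun y => g x * Complex.I + Complex.log (f y / f x) := by
      have : ∀ᶠ y in 𝓝 x, |g y - g x| < Real.pi := by
        have : Tendsto (fun y => |g y - g x|) (𝓝 x) (𝓝 0) := by
          have h : Continuous fun y => |g y - g x| := by fun_prop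
          simpa using h.tendsto x
        exact this.eventually_lt_const Real.pi_pos
      filter_upwards [this] with y hy
      rw [abs_lt] at hy
      rw [hfg y, hfg x, ← Complex.exp_sub, ← sub_mul, ← Complex.ofReal_sub, Complex.log_exp]
      · push_cast; ring
      · simpa using hy.1
      · simpa using hy.2.le
    refine HasDerivAt.congr_of_eventuallyEq ?_ hev
    have h2 := ((hd x hx).hasDerivAt.div_const (f x)).clog_real (by
      rw [div_self (hne x)]; exact Complex.one_mem_slitPlane)
    refine (h2.const_add _).congr_deriv ?_
    rw [div_self (hne x), div_one]
  refine ⟨g, hfg, ?_⟩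
  rw [integral_eq_of_hasDerivAt_off_countable_of_le (fun x => (g x : ℂ) * Complex.I) _ hab hS
    (by fun_prop) (fun x hx => hgd x hx.2) hi]
  ring

section
variable {E : Type*} [NormedAddCommGroup E] [InnerProductSpace ℂ E] [NormedSpace ℝ E]
  [IsScalarTower ℝ ℂ E]

/-- A normalised continuous family of vectors, smooth up to countably many points, that is real for
some real structure, and periodic (`σ = 1`) or antiperiodic (`σ = -1`). -/
structure RealFrame (p σ : ℝ) (w : ℝ → E) : Prop where
  norm_eq : ∀ α, ‖w α‖ = 1
  continuous : Continuous w
  differentiable : ∃ S : Set ℝ, S.Countable ∧ ∀ α ∉ S, DifferentiableAt ℝ w α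
  real : ∀ α β, (inner ℂ (w α) (w β)).im = 0
  period : ∀ α, w (α + p) = (σ : ℂ) • w α

variable {p σ : ℝ} {w u : ℝ → E}

-- The imaginary part vanishes by reality of the frame, the real part by normalisation.
omit [IsScalarTower ℝ ℂ E] in
theorem RealFrame.inner_deriv (h : RealFrame p σ w) {α : ℝ} {w' : E} (hw : HasDerivAt w w' α) :
    inner ℂ (w α) w' = 0 := by
  have h1 : HasDerivAt (fun β => (inner ℂ (w α) (w β)).im) _ α :=
    Complex.imCLM.hasFDerivAt.comp_hasDerivAt α ((hasDerivAt_const α (w α)).inner ℂ hw)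
  have h2 : HasDerivAt (fun β => (inner ℂ (w β) (w β)).re) _ α :=
    Complex.reCLM.hasFDerivAt.comp_hasDerivAt α (hw.inner ℂ hw)
  simp only [h.real] at h1
  have e1 := h1.unique (hasDerivAt_const α (0 : ℝ))
  have h3 : (fun x => (inner ℂ (w x) (w x)).re) = fun _ => (1 : ℝ) := by
    ext x
    rw [inner_self_eq_norm_sq_to_K, h.norm_eq]; simp
  rw [h3] at h2
  have e2 := h2.unique (hasDerivAt_const α (1 : ℝ))
  rw [Complex.reCLM_apply, Complex.add_re, ← inner_conj_symm w' (w α), Complex.conj_re] at e2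
  simp only [inner_zero_left, add_zero, Complex.imCLM_apply] at e1
  exact Complex.ext (by simp; linarith) (by simpa using e1)

theorem smul_hasDerivAt {f : ℝ → ℂ} {f' : ℂ} {w' : E} {α : ℝ} (hf : HasDerivAt f f' α)
    (hw : HasDerivAt w w' α) : HasDerivAt (fun α => f α • w α) (f α • w' + f' • w α) α :=
  hf.smul hw

theorem RealFrame.inner_smul_deriv (h : RealFrame p σ w) {f : ℝ → ℂ} {f' : ℂ} {w' : E} {α : ℝ}
    (hf : HasDerivAt f f' α) (hw : HasDerivAt w w' α) (h1 : ‖f α‖ = 1) :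
    inner ℂ (f α • w α) (deriv (fun α => f α • w α) α) = f' / f α := by
  have h2 : (starRingEnd ℂ) (f α) * f α = 1 := by
    rw [mul_comm, Complex.mul_conj, Complex.normSq_eq_norm_sq, h1]; simp
  have h3 : f α ≠ 0 := right_ne_zero_of_mul_eq_one h2
  rw [(smul_hasDerivAt hf hw).deriv, inner_add_right, inner_smul_left, inner_smul_left,
    inner_smul_right, inner_smul_right, h.inner_deriv hw, inner_self_eq_norm_sq_to_K, h.norm_eq]
  field_simp
  simp
  linear_combination f' * h2

/-- The phase of a periodic family in the line bundle spanned by a real frame. -/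
theorem RealFrame.phase (h : RealFrame p σ w) (hσ : σ = 1 ∨ σ = -1) (hp : 0 < p)
    (hu : ∀ α, ∃ a : ℂ, u α = a • w α) (hn : ∀ α, ‖u α‖ = 1) (hc : Continuous u)
    (hper : Function.Periodic u p)
    (hd : ∃ S : Set ℝ, S.Countable ∧ ∀ α ∉ S, DifferentiableAt ℝ u α)
    (hi : IntervalIntegrable (fun α => inner ℂ (u α) (deriv u α)) volume (-(p / 2)) (p / 2)) :
    ∃ n : ℤ, Complex.I * ∫ α in (-(p / 2))..(p / 2), inner ℂ (u α) (deriv u α) =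
      (if σ = 1 then 0 else Real.pi : ℝ) + 2 * Real.pi * n := by
  set f : ℝ → ℂ := fun α => inner ℂ (w α) (u α) with hf
  have huf : ∀ α, u α = f α • w α := fun α => by
    obtain ⟨a, ha⟩ := hu α
    simp [hf, ha, inner_self_eq_norm_sq_to_K, h.norm_eq]
  have hf1 : ∀ α, ‖f α‖ = 1 := fun α => by
    have := hn α
    rwa [huf, norm_smul, h.norm_eq, mul_one] at this
  obtain ⟨S, hS, hSd⟩ := hd
  obtain ⟨T, hT, hTd⟩ := h.differentiable
  have hfd : ∀ α ∉ S ∪ T, DifferentiableAt ℝ f α := fun α hα =>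
    ((hTd α fun h => hα (Or.inr h)).inner ℂ (hSd α fun h => hα (Or.inl h)))
  have hue : u = fun α => f α • w α := funext huf
  have heq : ∀ α ∉ S ∪ T, inner ℂ (u α) (deriv u α) = deriv f α / f α := fun α hα => by
    rw [hue]
    exact h.inner_smul_deriv (hfd α hα).hasDerivAt (hTd α fun h => hα (Or.inr h)).hasDerivAt (hf1 α)
  have hae : ∀ᵐ α ∂(volume : Measure ℝ), inner ℂ (u α) (deriv u α) = deriv f α / f α := by
    filter_upwards [(hS.union hT).ae_notMem volume] with α hα using heq α hα
  obtain ⟨g, hg, hint⟩ := exists_angle (f := f) (h.continuous.inner hc) hf1 (hS.union hT) hfd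
    (show -(p / 2) ≤ p / 2 by linarith) (hi.congr_ae (ae_restrict_of_ae hae))
  rw [intervalIntegral.integral_congr_ae (hae.mono fun α hα _ => hα), hint]
  -- `u` is periodic and `w` changes by `σ`, so the coefficient `f` must change by `σ`; this fixes
  -- the change of angle modulo `2π`.
  have hσf : f (p / 2) = σ * f (-(p / 2)) := by
    have h1 := h.period (-(p / 2))
    have h2 := hper (-(p / 2))
    rw [show -(p / 2) + p = p / 2 by ring] at h1 h2
    simp only [hf, h1, h2, inner_smul_left, Complex.conj_ofReal]
  rw [hg, hg] at hσf
  have hexp : Complex.exp ((g (p / 2) - g (-(p / 2))) * Complex.I) = σ := by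
    rw [sub_mul, Complex.exp_sub, hσf, mul_div_assoc, div_self (Complex.exp_ne_zero _), mul_one]
  rcases hσ with rfl | rfl
  · rw [Complex.ofReal_one, Complex.exp_eq_one_iff] at hexp
    obtain ⟨n, hn⟩ := hexp
    refine ⟨-n, ?_⟩
    rw [hn]
    simp
    linear_combination (n * (2 * Real.pi)) * Complex.I_sq
  · have : Complex.exp ((g (p / 2) - g (-(p / 2))) * Complex.I + Real.pi * Complex.I) = 1 := by
      rw [Complex.exp_add, hexp, Complex.exp_pi_mul_I]; simp
    rw [Complex.exp_eq_one_iff] at this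
    obtain ⟨n, hn⟩ := this
    refine ⟨-n, ?_⟩
    rw [if_neg (by norm_num)]
    push_cast
    linear_combination Complex.I * hn + (2 * n * Real.pi - Real.pi) * Complex.I_sq

/-- A periodic family in the line bundle spanned by a real frame with phase exactly `0` or `π`. -/
theorem RealFrame.exists_phase (h : RealFrame p σ w) (hσ : σ = 1 ∨ σ = -1) (hp : 0 < p) :
    ∃ f : ℝ → ℂ, (∀ α, ‖f α • w α‖ = 1) ∧ Continuous (fun α => f α • w α) ∧
      Function.Periodic (fun α => f α • w α) p ∧
      (∃ S : Set ℝ, S.Countable ∧ ∀ α ∉ S, DifferentiableAt ℝ (fun α => f α • w α) α) ∧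
      IntervalIntegrable (fun α => inner ℂ (f α • w α) (deriv (fun α => f α • w α) α)) volume
        (-(p / 2)) (p / 2) ∧
      Complex.I * ∫ α in (-(p / 2))..(p / 2),
        inner ℂ (f α • w α) (deriv (fun α => f α • w α) α) = (if σ = 1 then 0 else Real.pi : ℝ) := by
  obtain ⟨T, hT, hTd⟩ := h.differentiable
  -- The factor `exp (ikα)` compensates the sign `σ` over one period and has phase `-kp`. The choice
  -- `k = -π / p` makes this `π` rather than `-π`.
  obtain ⟨k, hk, hkσ⟩ : ∃ k : ℝ, Complex.exp (k * p * Complex.I) = σ ∧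
      -k * p = (if σ = 1 then 0 else Real.pi : ℝ) := by
    rcases hσ with rfl | rfl
    · exact ⟨0, by simp, by simp⟩
    · have hp' : (p : ℂ) ≠ 0 := by exact_mod_cast hp.ne'
      refine ⟨-Real.pi / p, ?_, ?_⟩
      · rw [show ((-Real.pi / p : ℝ) * p * Complex.I : ℂ) = -(Real.pi * Complex.I) by
          push_cast; field_simp, Complex.exp_neg, Complex.exp_pi_mul_I]
        norm_num
      · rw [if_neg (by norm_num)]; field_simp
  have hσ2 : (σ : ℂ) * σ = 1 := by rcases hσ with rfl | rfl <;> norm_num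
  let f : ℝ → ℂ := fun α => Complex.exp (k * α * Complex.I)
  have hf1 : ∀ α, ‖f α‖ = 1 := fun α => by
    have := Complex.norm_exp_ofReal_mul_I (k * α)
    simpa [f] using this
  have hfd : ∀ α, HasDerivAt f (k * Complex.I * f α) α := fun α => by
    have h1 : HasDerivAt (fun α : ℝ => (k * α * Complex.I : ℂ)) (k * 1 * Complex.I) α :=
      ((hasDerivAt_id α).ofReal_comp.const_mul (k : ℂ)).mul_const Complex.I
    refine h1.cexp.congr_deriv ?_
    simp only [f]; ring
  have hae : ∀ᵐ α ∂(volume : Measure ℝ),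
      inner ℂ (f α • w α) (deriv (fun α => f α • w α) α) = k * Complex.I := by
    filter_upwards [hT.ae_notMem volume] with α hα
    have hne : f α ≠ 0 := Complex.exp_ne_zero _
    rw [h.inner_smul_deriv (hfd α) (hTd α hα).hasDerivAt (hf1 α)]
    field_simp
  refine ⟨f, fun α => by rw [norm_smul, hf1, h.norm_eq, one_mul],
    (by fun_prop : Continuous f).smul h.continuous, fun α => ?_,
    ⟨T, hT, fun α hα => (smul_hasDerivAt (hfd α) (hTd α hα).hasDerivAt).differentiableAt⟩, ?_, ?_⟩
  · simp only [h.period, smul_smul, f]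
    congr 1
    push_cast
    rw [mul_add, add_mul, Complex.exp_add, hk, mul_assoc, hσ2, mul_one]
  · refine (intervalIntegrable_const (c := (k * Complex.I : ℂ))).congr_ae (ae_restrict_of_ae ?_)
    exact hae.mono fun α hα => hα.symm
  · rw [intervalIntegral.integral_congr_ae (hae.mono fun α hα _ => hα), ← hkσ]
    simp
    linear_combination (p * k) * Complex.I_sq

end

end DimerChain
-- Differentiable curves of functions, and the reflection on `L²(D)`
namespace DimerChain

section
variable {E : Type*} [NormedAddCommGroup E] [InnerProductSpace ℂ E] [NormedSpace ℝ E]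
  [IsScalarTower ℝ ℂ E]

theorem RealFrame.of_ne_zero {p σ : ℝ} (hσ : σ = 1 ∨ σ = -1) {v : ℝ → E} (h0 : ∀ α, v α ≠ 0)
    (hc : Continuous v) (hd : ∃ S : Set ℝ, S.Countable ∧ ∀ α ∉ S, DifferentiableAt ℝ v α)
    (hr : ∀ α β, (inner ℂ (v α) (v β)).im = 0) (hp : ∀ α, v (α + p) = (σ : ℂ) • v α) :
    RealFrame p σ fun α => ((‖v α‖⁻¹ : ℝ) : ℂ) • v α where
  norm_eq α := by
    have := norm_ne_zero_iff.2 (h0 α)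
    rw [norm_smul, Complex.norm_real, norm_inv, norm_norm, inv_mul_cancel₀ this]
  continuous := by
    have : Continuous fun α => ‖v α‖⁻¹ := hc.norm.inv₀ fun α => norm_ne_zero_iff.2 (h0 α)
    exact (Complex.continuous_ofReal.comp this).smul hc
  differentiable := by
    obtain ⟨S, hS, hd⟩ := hd
    refine ⟨S, hS, fun α hα => ?_⟩
    have h1 : DifferentiableAt ℝ (fun α => ‖v α‖⁻¹) α :=
      ((hd α hα).norm ℂ (h0 α)).inv (norm_ne_zero_iff.2 (h0 α))
    have h2 : DifferentiableAt ℝ (fun α => ((‖v α‖⁻¹ : ℝ) : ℂ)) α :=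
      Complex.ofRealCLM.differentiableAt.comp α h1
    exact h2.smul (hd α hα)
  real α β := by
    rw [inner_smul_left, inner_smul_right, Complex.conj_ofReal, Complex.im_ofReal_mul,
      Complex.im_ofReal_mul, hr, mul_zero, mul_zero]
  period α := by
    have : ‖(σ : ℂ)‖ = 1 := by rcases hσ with rfl | rfl <;> simp
    rw [hp, norm_smul, this, one_mul, smul_comm]

end

/-- If the derivative of `F` in the parameter is jointly continuous, then the curve
`k ↦ F (k, ·)` is differentiable in the space of continuous functions. -/
theorem hasDerivAt_curry {K : Type*} [TopologicalSpace K] [CompactSpace K] {F F' : C(ℝ × K, ℂ)}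
    (h : ∀ k x, HasDerivAt (fun k => F (k, x)) (F' (k, x)) k) (k : ℝ) :
    HasDerivAt (fun k => F.curry k) (F'.curry k) k := by
  -- The curve is a primitive of a continuous curve in the Banach space of continuous functions, so
  -- the fundamental theorem of calculus applies there.
  have e : (fun k => F.curry k) = fun k => F.curry 0 + ∫ t in (0 : ℝ)..k, F'.curry t := by
    ext k x
    have h1 := (ContinuousMap.evalCLM ℝ x : C(K, ℂ) →L[ℝ] ℂ).intervalIntegral_comp_comm
      (F'.curry.continuous.intervalIntegrable (μ := volume) 0 k)
    have h2 := intervalIntegral.integral_eq_sub_of_hasDerivAt (fun t _ => h t x)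
      ((by fun_prop : Continuous fun t => F' (t, x)).intervalIntegrable 0 k)
    have h3 : (∫ t in (0 : ℝ)..k, F'.curry t) x = F (k, x) - F (0, x) := h1.symm.trans h2
    rw [ContinuousMap.add_apply, h3]
    simp
  rw [e]
  exact (F'.curry.continuous.integral_hasStrictDerivAt 0 k).hasDerivAt.const_add _

/-- The slope of `h` is the slope of `ω` times the `dslope` of `f`, which tends to `f' ≠ 0` by
continuity of `ω`. Differentiability of `f` at the single point `ω α` is enough. -/
theorem differentiableAt_of_comp_eq {f h ω : ℝ → ℝ} {f' h' α : ℝ} (hω : ContinuousAt ω α)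
    (hf : HasDerivAt f f' (ω α)) (hf' : f' ≠ 0) (hh : HasDerivAt h h' α)
    (e : ∀ β, f (ω β) = h β) : DifferentiableAt ℝ ω α := by
  have h1 : ContinuousAt (fun β => dslope f (ω α) (ω β)) α :=
    ContinuousAt.comp (g := dslope f (ω α)) (continuousAt_dslope_same.2 hf.differentiableAt) hω
  have h1' : Tendsto (fun β => dslope f (ω α) (ω β)) (𝓝[≠] α) (𝓝 f') := by
    have := h1.tendsto
    rw [dslope_same, hf.deriv] at this
    exact this.mono_left nhdsWithin_le_nhds
  have h2 := (hasDerivAt_iff_tendsto_slope.1 hh).div h1' hf'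
  refine (hasDerivAt_iff_tendsto_slope.2 (h2.congr' ?_)).differentiableAt
  filter_upwards [h1'.eventually_ne hf'] with β hβ
  have h3 : (ω β - ω α) * dslope f (ω α) (ω β) = h β - h α := by
    have := sub_smul_dslope f (ω α) (ω β)
    rwa [smul_eq_mul, e, e] at this
  simp only [Pi.div_apply, slope_def_field]
  rw [← h3]
  field_simp

section
variable (c : DimerChain)

theorem volume_D_lt_top : volume c.D < ⊤ :=
  (measure_union_le _ _).trans_lt (ENNReal.add_lt_top.2 ⟨by simp, by simp⟩)

instance : IsFiniteMeasure (volume.restrict c.D) := ⟨by simpa using c.volume_D_lt_top⟩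

/-- The extension of functions on the unit cell by constants. -/
noncomputable def extendCell : C(Set.Icc 0 c.L, ℂ) →L[ℝ] BoundedContinuousFunction ℝ ℂ :=
  LinearMap.mkContinuous
    { toFun := fun f => (BoundedContinuousFunction.mkOfCompact f).compContinuous
        ⟨Set.projIcc 0 c.L c.L_pos.le, continuous_projIcc⟩
      map_add' := fun _ _ => rfl
      map_smul' := fun _ _ => rfl } 1 fun f => by
    rw [one_mul, BoundedContinuousFunction.norm_le (norm_nonneg _)]
    exact fun x => f.norm_coe_le_norm _

/-- Continuous functions on the unit cell as elements of `L²(D)`. -/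
noncomputable def restrictD : C(Set.Icc 0 c.L, ℂ) →L[ℝ] Lp ℂ 2 (volume.restrict c.D) :=
  (BoundedContinuousFunction.toLp 2 (volume.restrict c.D) ℝ).comp c.extendCell

theorem restrictD_ae (hℓ : c.ℓ₁ = c.ℓ₂) (f : C(Set.Icc 0 c.L, ℂ)) {g : ℝ → ℂ}
    (h : ∀ x : Set.Icc 0 c.L, f x = g x) : c.restrictD f =ᵐ[volume.restrict c.D] g := by
  have hD : MeasurableSet c.D := (isOpen_Ioo.union isOpen_Ioo).measurableSet
  have h1 : c.restrictD f =ᵐ[volume.restrict c.D] fun x => f (Set.projIcc 0 c.L c.L_pos.le x) :=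
    BoundedContinuousFunction.coeFn_toLp 2 (volume.restrict c.D) ℝ _
  refine h1.trans ?_
  filter_upwards [ae_restrict_mem hD] with x hx
  rw [h, Set.projIcc_of_mem _ (Set.Ico_subset_Icc_self (D_subset_Ico hℓ hx))]

theorem reflect_mem_D (hℓ : c.ℓ₁ = c.ℓ₂) (x : ℝ) :
    2 * c.ℓ₁ + c.s₁ - x ∈ c.D ↔ x ∈ c.D := by
  simp only [D, ← hℓ, Set.mem_union, Set.mem_Ioo]
  constructor <;> rintro (h | h)
  · right; constructor <;> linarith [h.1, h.2]
  · left; constructor <;> linarith [h.1, h.2]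
  · right; constructor <;> linarith [h.1, h.2]
  · left; constructor <;> linarith [h.1, h.2]

/-- Functions on `D` that are conjugated by the reflection have real inner products. -/
theorem im_inner_eq_zero (hℓ : c.ℓ₁ = c.ℓ₂) {u v : Lp ℂ 2 (volume.restrict c.D)} {f g : ℝ → ℂ}
    (hu : u =ᵐ[volume.restrict c.D] f) (hv : v =ᵐ[volume.restrict c.D] g)
    (hf : ∀ x, f (2 * c.ℓ₁ + c.s₁ - x) = (starRingEnd ℂ) (f x))
    (hg : ∀ x, g (2 * c.ℓ₁ + c.s₁ - x) = (starRingEnd ℂ) (g x)) : (inner ℂ u v).im = 0 := by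
  have hD : MeasurableSet c.D := (isOpen_Ioo.union isOpen_Ioo).measurableSet
  have h1 : inner ℂ u v = ∫ x, c.D.indicator (fun x => inner ℂ (f x) (g x)) x := by
    rw [L2.inner_def, integral_indicator hD]
    refine integral_congr_ae ?_
    filter_upwards [hu, hv] with x h1 h2
    rw [h1, h2]
  -- The reflection preserves Lebesgue measure and `D` and conjugates the integrand, so the integral
  -- equals its conjugate.
  rw [← Complex.conj_eq_iff_im, h1, ← integral_conj,
    ← integral_sub_left_eq_self (fun x => c.D.indicator (fun x => inner ℂ (f x) (g x)) x) volume
      (2 * c.ℓ₁ + c.s₁)]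
  refine integral_congr_ae (Eventually.of_forall fun x => ?_)
  by_cases hx : x ∈ c.D
  · simp only [Set.indicator_of_mem hx, Set.indicator_of_mem ((c.reflect_mem_D hℓ x).2 hx), hf, hg]
    simp
  · simp only [Set.indicator_of_notMem hx,
      Set.indicator_of_notMem (mt (c.reflect_mem_D hℓ x).1 hx), map_zero]

end

end DimerChain
-- An explicit formula for the modes on `D`
namespace DimerChain

/-- An odd continuous function equal to the sign outside `(-1, 1)`. -/
noncomputable def softSign (t : ℝ) : ℝ := t / max 1 |t|

theorem softSign_neg (t : ℝ) : softSign (-t) = -softSign t := by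
  simp [softSign, neg_div]

theorem softSign_of_one_le {t : ℝ} (h : 1 ≤ t) : softSign t = 1 := by
  have : 0 < t := by linarith
  rw [softSign, abs_of_pos this, max_eq_right h, div_self this.ne']

@[fun_prop]
theorem continuous_softSign : Continuous softSign :=
  continuous_id.div (by fun_prop) fun t => (lt_max_of_lt_left one_pos).ne'

theorem differentiableAt_sn {f : ℝ → ℝ} {x : ℝ} (hf : DifferentiableAt ℝ f x) (h0 : f x ≠ 0)
    (y : ℝ) : DifferentiableAt ℝ (fun x => sn (f x) y) x := by
  have h : (fun x => sn (f x) y) =ᶠ[𝓝 x] fun x => Real.sin (f x * y) / f x := by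
    filter_upwards [hf.continuousAt.eventually_ne h0] with t ht
    exact sn_of_ne_zero ht y
  exact DifferentiableAt.congr_of_eventuallyEq ((hf.mul_const y).sin.div hf h0) h

section
variable (c : DimerChain)

/-- The depth of a point of `D` inside its resonator, measured from the first gap. -/
noncomputable def depth (x : ℝ) : ℝ := |x - (c.ℓ₁ + c.s₁ / 2)| - c.s₁ / 2

/-- The sign that distinguishes the two resonators. -/
noncomputable def side (x : ℝ) : ℂ := softSign ((x - (c.ℓ₁ + c.s₁ / 2)) / (c.s₁ / 2))

@[fun_prop] theorem continuous_depth : Continuous c.depth := by unfold depth; fun_prop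

@[fun_prop] theorem continuous_side : Continuous c.side := by
  have := (half_pos c.s₁_pos).ne'
  unfold side
  fun_prop

theorem depth_reflect (x : ℝ) : c.depth (2 * c.ℓ₁ + c.s₁ - x) = c.depth x := by
  unfold depth
  rw [← abs_neg]
  ring_nf

theorem side_reflect (x : ℝ) : c.side (2 * c.ℓ₁ + c.s₁ - x) = -c.side x := by
  unfold side
  rw [← Complex.ofReal_neg, ← softSign_neg]
  ring_nf

/-- The solution with the state `(A, i B)` in the resonators. -/
noncomputable def profile (δ ω A B x : ℝ) : ℂ :=
  (A * Real.cos (ω / c.v * (c.s₁ / 2)) : ℝ) * (Real.cos (ω / c.vb * c.depth x) : ℝ)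
  + (B * sn (ω / c.v) (c.s₁ / 2) / δ : ℝ) *
    (Complex.I * c.side x * (Real.cos (ω / c.vb * c.depth x) : ℝ))
  + (-(δ * (ω / c.v) ^ 2 * A * sn (ω / c.v) (c.s₁ / 2)) : ℝ) * (sn (ω / c.vb) (c.depth x) : ℝ)
  + (B * Real.cos (ω / c.v * (c.s₁ / 2)) : ℝ) *
    (Complex.I * c.side x * (sn (ω / c.vb) (c.depth x) : ℝ))

/-- The reflection keeps `depth` and flips `side`, and `side` occurs only together with the factor
`Complex.I`. -/
theorem profile_reflect (δ ω A B x : ℝ) : c.profile δ ω A B (2 * c.ℓ₁ + c.s₁ - x) =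
    (starRingEnd ℂ) (c.profile δ ω A B x) := by
  have h : (starRingEnd ℂ) (c.side x) = c.side x := Complex.conj_ofReal _
  simp only [profile, depth_reflect, side_reflect, map_add, map_mul, Complex.conj_ofReal,
    Complex.conj_I, h]
  ring

/-- On `D` the argument of `softSign` has modulus at least `1`, so `side` is `1` or `-1`. In the
gaps `profile` need not be a solution; it only has to be continuous, since `L²(D)` does not see it
there. -/
theorem profile_eq_cell (hℓ : c.ℓ₁ = c.ℓ₂) (δ ω A B : ℝ) {x : ℝ} (hx : x ∈ c.D) :
    c.profile δ ω A B x = c.cell δ ω A (Complex.I * B) x := by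
  have p1 := c.ℓ₁_pos
  have p2 := c.s₁_pos
  have p3 := (half_pos c.s₁_pos)
  rcases hx with hx | hx
  · have h1 : c.depth x = c.ℓ₁ - x := by
      rw [depth, abs_of_neg (by linarith [hx.2])]; ring
    have h2 : c.side x = -1 := by
      rw [side, ← neg_neg ((_ : ℝ) / _), softSign_neg, softSign_of_one_le]
      · simp
      · rw [← neg_div, one_le_div p3]; linarith [hx.2]
    rw [cell, if_pos hx.2.le, profile, h1, h2]
    simp only [wave, resP, resR, flux]
    push_cast
    ring
  · rw [← hℓ] at hx
    have h1 : c.depth x = x - (c.ℓ₁ + c.s₁) := by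
      rw [depth, abs_of_pos (by linarith [hx.1])]; ring
    have h2 : c.side x = 1 := by
      rw [side, softSign_of_one_le, Complex.ofReal_one]
      rw [one_le_div p3]; linarith [hx.1]
    rw [cell, if_neg (by linarith [hx.1]), if_neg (by linarith [hx.1]), if_pos hx.2.le, profile, h1,
      h2]
    simp only [wave, resP, resR, flux]
    push_cast
    ring

variable {A B ω : ℝ → ℝ}

/-- A family of solutions in the resonators as a continuous function of parameter and place. -/
noncomputable def profileMap (δ : ℝ) (hA : Continuous A) (hB : Continuous B) (hω : Continuous ω) :
    C(ℝ × Set.Icc 0 c.L, ℂ) :=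
  ⟨fun p => c.profile δ (ω p.1) (A p.1) (B p.1) p.2, by unfold profile; fun_prop⟩

/-- A standing wave with a weight, as a function of wave number and place. -/
noncomputable def cosMap (χ : C(ℝ, ℂ)) : C(ℝ × Set.Icc 0 c.L, ℂ) :=
  ⟨fun p => χ p.2 * (Real.cos (p.1 * c.depth p.2) : ℝ), by fun_prop⟩

noncomputable def sinMap (χ : C(ℝ, ℂ)) : C(ℝ × Set.Icc 0 c.L, ℂ) :=
  ⟨fun p => χ p.2 * (Real.sin (p.1 * c.depth p.2) : ℝ), by fun_prop⟩

theorem differentiableAt_cosMap (χ : C(ℝ, ℂ)) (k : ℝ) :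
    DifferentiableAt ℝ (fun k => (c.cosMap χ).curry k) k := by
  let F' : C(ℝ × Set.Icc 0 c.L, ℂ) :=
    ⟨fun p => χ p.2 * (-Real.sin (p.1 * c.depth p.2) * c.depth p.2 : ℝ), by fun_prop⟩
  refine (hasDerivAt_curry (F' := F') (fun k x => ?_) k).differentiableAt
  exact ((((hasDerivAt_id k).mul_const (c.depth x)).cos.ofReal_comp).const_mul (χ x)).congr_deriv
    (by simp [F'])

theorem differentiableAt_sinMap (χ : C(ℝ, ℂ)) (k : ℝ) :
    DifferentiableAt ℝ (fun k => (c.sinMap χ).curry k) k := by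
  let F' : C(ℝ × Set.Icc 0 c.L, ℂ) :=
    ⟨fun p => χ p.2 * (Real.cos (p.1 * c.depth p.2) * c.depth p.2 : ℝ), by fun_prop⟩
  refine (hasDerivAt_curry (F' := F') (fun k x => ?_) k).differentiableAt
  exact ((((hasDerivAt_id k).mul_const (c.depth x)).sin.ofReal_comp).const_mul (χ x)).congr_deriv
    (by simp [F'])

/-- Near a parameter with nonzero frequency `sn` becomes a quotient, and the curve is a sum of
scalar functions of `α` times the curves of `cosMap` and `sinMap` evaluated at the wave number. -/
theorem differentiableAt_profileMap (δ : ℝ) (hA : Continuous A) (hB : Continuous B)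
    (hω : Continuous ω) {α : ℝ} (dA : DifferentiableAt ℝ A α) (dB : DifferentiableAt ℝ B α)
    (dω : DifferentiableAt ℝ ω α) (h0 : ω α ≠ 0) :
    DifferentiableAt ℝ (fun α => (c.profileMap δ hA hB hω).curry α) α := by
  have hv := c.v_pos.ne'
  have hvb := c.vb_pos.ne'
  let χ : C(ℝ, ℂ) := ⟨fun x => Complex.I * c.side x, by fun_prop⟩
  have dk : DifferentiableAt ℝ (fun α => ω α / c.vb) α := by fun_prop
  have hk : ω α / c.vb ≠ 0 := div_ne_zero h0 hvb
  have ds : DifferentiableAt ℝ (fun α => sn (ω α / c.v) (c.s₁ / 2)) α :=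
    differentiableAt_sn (f := fun α => ω α / c.v) (by fun_prop) (div_ne_zero h0 hv) _
  have hev : (fun α => (c.profileMap δ hA hB hω).curry α) =ᶠ[𝓝 α] fun α =>
      (A α * Real.cos (ω α / c.v * (c.s₁ / 2))) • (c.cosMap 1).curry (ω α / c.vb)
      + (B α * sn (ω α / c.v) (c.s₁ / 2) / δ) • (c.cosMap χ).curry (ω α / c.vb)
      + (-(δ * (ω α / c.v) ^ 2 * A α * sn (ω α / c.v) (c.s₁ / 2)) / (ω α / c.vb)) •
        (c.sinMap 1).curry (ω α / c.vb)
      + (B α * Real.cos (ω α / c.v * (c.s₁ / 2)) / (ω α / c.vb)) •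
        (c.sinMap χ).curry (ω α / c.vb) := by
    filter_upwards [dk.continuousAt.eventually_ne hk] with β hβ
    have hβ' : ((ω β / c.vb : ℝ) : ℂ) ≠ 0 := by exact_mod_cast hβ
    ext x
    simp only [profileMap, ContinuousMap.curry_apply, ContinuousMap.coe_mk, profile, cosMap, sinMap,
      ContinuousMap.add_apply, ContinuousMap.smul_apply, ContinuousMap.one_apply,
      sn_of_ne_zero hβ, χ, Complex.real_smul, one_mul]
    generalize ω β / c.vb = k at *
    push_cast
    field_simp
  refine DifferentiableAt.congr_of_eventuallyEq ?_ hev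
  have d1 (χ : C(ℝ, ℂ)) : DifferentiableAt ℝ (fun α => (c.cosMap χ).curry (ω α / c.vb)) α :=
    DifferentiableAt.comp (g := fun k => (c.cosMap χ).curry k) α
      (c.differentiableAt_cosMap χ _) dk
  have d2 (χ : C(ℝ, ℂ)) : DifferentiableAt ℝ (fun α => (c.sinMap χ).curry (ω α / c.vb)) α :=
    DifferentiableAt.comp (g := fun k => (c.sinMap χ).curry k) α
      (c.differentiableAt_sinMap χ _) dk
  have r1 : DifferentiableAt ℝ (fun α => A α * Real.cos (ω α / c.v * (c.s₁ / 2))) α := by fun_prop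
  have r2 : DifferentiableAt ℝ (fun α => B α * sn (ω α / c.v) (c.s₁ / 2) / δ) α := by fun_prop
  have r3 : DifferentiableAt ℝ (fun α =>
      -(δ * (ω α / c.v) ^ 2 * A α * sn (ω α / c.v) (c.s₁ / 2)) / (ω α / c.vb)) α :=
    DifferentiableAt.fun_div (by fun_prop) dk hk
  have r4 : DifferentiableAt ℝ (fun α =>
      B α * Real.cos (ω α / c.v * (c.s₁ / 2)) / (ω α / c.vb)) α :=
    DifferentiableAt.fun_div (by fun_prop) dk hk
  exact (((r1.fun_smul (d1 1)).fun_add (r2.fun_smul (d1 χ))).fun_add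
    (r3.fun_smul (d2 1))).fun_add (r4.fun_smul (d2 χ))

end

end DimerChain
-- Real frames of the two bands and their Zak phases
namespace DimerChain

section
variable {c : DimerChain} {δ ε τ σ : ℝ}

theorem Closes.smul {ω : ℝ} {e y z : ℂ} (h : c.Closes δ ω e y z) (a : ℂ) :
    c.Closes δ ω e (a * y) (a * z) := by
  obtain ⟨h1, h2⟩ := h
  unfold Closes
  rw [← mul_neg, farP_smul, farP_smul, farR_smul, farR_smul, h1, h2]
  constructor <;> ring

theorem OnBand.pos_of_sin_ne_zero (h : c.Window δ ε) {α ω : ℝ} (hω : c.OnBand δ ε τ α ω)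
    (hs : Real.sin (α * c.L / 2) ≠ 0) : 0 < ω := by
  refine hω.1.1.lt_of_ne fun h0 => hs ?_
  have := hω.2.2.2
  rw [← h0, h.a_zero, h.d_zero, mul_one] at this
  have h1 := Real.cos_sq_add_sin_sq (α * c.L / 2)
  rw [← this] at h1
  exact pow_eq_zero_iff two_ne_zero |>.1 (by linarith)

/-- The bands are differentiable inside the two halves of the Brillouin zone. -/
theorem OnBand.differentiableAt (hτ : τ = 1 ∨ τ = -1) (h : c.Window δ ε) {ω : ℝ → ℝ}
    (hω : ∀ α, c.OnBand δ ε τ α (ω α)) {α : ℝ} (hs : Real.sin (α * c.L / 2) ≠ 0)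
    (hc : Real.cos (α * c.L / 2) ≠ 0) : DifferentiableAt ℝ ω α := by
  have hpos := (hω α).pos_of_sin_ne_zero h hs
  obtain ⟨hm, h1, h2, h3⟩ := hω α
  obtain ⟨a', ha', hda⟩ := h.a_deriv _ ⟨hpos, hm.2⟩
  obtain ⟨d', hd', hdd⟩ := h.d_deriv _ ⟨hpos, hm.2⟩
  have hne : c.tA δ (ω α) * c.tD δ (ω α) ≠ 0 := by rw [h3]; exact pow_ne_zero _ hc
  -- The derivative of the product is nonzero because `tA` and `tD` have the same strict sign on a
  -- band while both derivatives are negative.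
  have hf' : a' * c.tD δ (ω α) + c.tA δ (ω α) * d' ≠ 0 := by
    have ha := left_ne_zero_of_mul hne
    have hd := right_ne_zero_of_mul hne
    rcases hτ with rfl | rfl
    · have ha := lt_of_le_of_ne (by linarith : 0 ≤ c.tA δ (ω α)) ha.symm
      have hd := lt_of_le_of_ne (by linarith : 0 ≤ c.tD δ (ω α)) hd.symm
      nlinarith [mul_pos_of_neg_of_neg ha' (neg_neg_of_pos hd),
        mul_pos_of_neg_of_neg hd' (neg_neg_of_pos ha)]
    · have ha := lt_of_le_of_ne (by linarith : c.tA δ (ω α) ≤ 0) ha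
      have hd := lt_of_le_of_ne (by linarith : c.tD δ (ω α) ≤ 0) hd
      nlinarith [mul_pos_of_neg_of_neg ha' hd, mul_pos_of_neg_of_neg hd' ha]
  have hh : HasDerivAt (fun α => Real.cos (α * c.L / 2) ^ 2) _ α :=
    (by fun_prop : DifferentiableAt ℝ (fun α => Real.cos (α * c.L / 2) ^ 2) α).hasDerivAt
  exact differentiableAt_of_comp_eq (OnBand.continuous hτ h hω).continuousAt (hda.mul hdd) hf' hh
    fun β => (hω β).2.2.2

/-- The quasiperiodicities at the centre and the ends of the Brillouin zone. -/
theorem countable_sin_eq_zero (c : DimerChain) : {α | Real.sin (α * c.L) = 0}.Countable := by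
  refine (Set.countable_range fun n : ℤ => n * Real.pi / c.L).mono fun α hα => ?_
  obtain ⟨n, hn⟩ := Real.sin_eq_zero_iff.1 hα
  have := c.L_pos.ne'
  exact ⟨n, by simp only [hn]; field_simp⟩

/-- The profiles, normalised in `L²(D)`, form a `RealFrame` with sign `σ`. By non-degeneracy every
mode family is a multiple of it, so the phase computations for real frames apply. -/
theorem zak_of_realMode (hℓ : c.ℓ₁ = c.ℓ₂) (hs : c.s₁ ≠ c.s₂) (h : c.Window δ ε)
    (hτ : τ = 1 ∨ τ = -1) (hσ : σ = 1 ∨ σ = -1) {ω A B : ℝ → ℝ}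
    (hω : ∀ α, c.OnBand δ ε τ α (ω α)) (hA : Continuous A) (hB : Continuous B)
    (hAd : ∀ α, Real.sin (α * c.L) ≠ 0 → DifferentiableAt ℝ A α)
    (hBd : ∀ α, Real.sin (α * c.L) ≠ 0 → DifferentiableAt ℝ B α) (h0 : ∀ α, A α ≠ 0 ∨ B α ≠ 0)
    (hm : ∀ α, c.RealMode δ α (ω α) (A α) (B α))
    (hAp : ∀ α, A (α + 2 * Real.pi / c.L) = σ * A α)
    (hBp : ∀ α, B (α + 2 * Real.pi / c.L) = σ * B α) :
    (∃ u : ℝ → Lp ℂ 2 (volume.restrict c.D), c.IsModeFamily δ ω u ∧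
      c.zak u = (if σ = 1 then 0 else Real.pi : ℝ)) ∧
    ∀ u : ℝ → Lp ℂ 2 (volume.restrict c.D), c.IsModeFamily δ ω u →
      ∃ n : ℤ, c.zak u = (if σ = 1 then 0 else Real.pi : ℝ) + 2 * Real.pi * n := by
  have hcω := OnBand.continuous hτ h hω
  have hL := c.L_pos
  have hhalf : 2 * Real.pi / c.L / 2 = Real.pi / c.L := by ring
  set p := 2 * Real.pi / c.L with hp
  have hp0 : 0 < p := by have := Real.pi_pos; positivity
  have hωp : ∀ α, ω (α + p) = ω α := fun α => (hω _).unique hτ h (hω α).add_period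
  set v : ℝ → Lp ℂ 2 (volume.restrict c.D) :=
    fun α => c.restrictD ((c.profileMap δ hA hB hcω).curry α) with hv
  have hvp : ∀ α, v α =ᵐ[volume.restrict c.D] c.profile δ (ω α) (A α) (B α) := fun α =>
    c.restrictD_ae hℓ _ fun x => rfl
  have hDo : IsOpen c.D := isOpen_Ioo.union isOpen_Ioo
  have hDm := hDo.measurableSet
  have hvc : ∀ α, v α =ᵐ[volume.restrict c.D] c.cell δ (ω α) (A α) (Complex.I * B α) := fun α => by
    filter_upwards [hvp α, ae_restrict_mem hDm] with x hx hxD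
    rw [hx, c.profile_eq_cell hℓ _ _ _ _ hxD]
  have hv0 : ∀ α, v α ≠ 0 := by
    intro α hα
    have h1 : c.cell δ (ω α) (A α) (Complex.I * B α) =ᵐ[volume.restrict c.D] fun _ => 0 := by
      have h2 := Lp.coeFn_zero ℂ 2 (volume.restrict c.D)
      rw [← hα] at h2
      exact (hvc α).symm.trans h2
    have h3 := Measure.eqOn_open_of_ae_eq h1 hDo (c.continuous_cell δ _ _ _ h.δ_pos).continuousOn
      continuousOn_const
    have h4 := eq_zero_of_cell_eq_zero hℓ h.δ_pos h3
    have := h0 α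
    simp at h4
    tauto
  have hframe := RealFrame.of_ne_zero (p := p) hσ hv0
    (c.restrictD.continuous.comp (ContinuousMap.continuous _))
    ⟨_, c.countable_sin_eq_zero, fun α hα => by
      have hsc : Real.sin (α * c.L) = 2 * Real.sin (α * c.L / 2) * Real.cos (α * c.L / 2) := by
        rw [← Real.sin_two_mul]; ring_nf
      have hα' : Real.sin (α * c.L) ≠ 0 := hα
      have h1 := hα'
      rw [hsc] at h1
      have h2 := right_ne_zero_of_mul (left_ne_zero_of_mul h1)
      have h3 := right_ne_zero_of_mul h1
      exact c.restrictD.differentiableAt.comp α (c.differentiableAt_profileMap δ hA hB hcω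
        (hAd α hα') (hBd α hα') (OnBand.differentiableAt hτ h hω h2 h3)
        ((hω α).pos_of_sin_ne_zero h h2).ne')⟩
    (fun α β => c.im_inner_eq_zero hℓ (hvp α) (hvp β) (c.profile_reflect _ _ _ _)
      (c.profile_reflect _ _ _ _))
    (fun α => by
      refine Lp.ext ?_
      filter_upwards [hvp (α + p), hvp α, Lp.coeFn_smul (σ : ℂ) (v α)] with x h1 h2 h3
      rw [h1, h3, Pi.smul_apply, h2, hωp, hAp, hBp, smul_eq_mul]
      simp only [profile]
      push_cast
      ring)
  have hmode : ∀ α (a : ℂ), ∃ ψ : ℝ → ℂ, c.IsMode δ α (ω α) ψ ∧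
      ((a • v α : Lp ℂ 2 (volume.restrict c.D)) =ᵐ[volume.restrict c.D] ψ) ∧
      (a ≠ 0 → ψ ≠ 0) := by
    intro α a
    obtain ⟨ψ, hψ, hψc⟩ := (((hm α).closes h.δ_pos).smul a).exists_isMode hℓ h.δ_pos
    have hae : (a • v α : Lp ℂ 2 (volume.restrict c.D)) =ᵐ[volume.restrict c.D] ψ := by
      filter_upwards [Lp.coeFn_smul a (v α), hvc α, ae_restrict_mem hDm] with x h1 h2 h3
      rw [h1, Pi.smul_apply, h2, hψc x (D_subset_Ico hℓ h3), cell_smul, smul_eq_mul]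
    refine ⟨ψ, hψ, hae, fun ha hψ0 => ?_⟩
    have : a • v α = 0 := Lp.ext ((hae.trans (by rw [hψ0])).trans (Lp.coeFn_zero ℂ 2 _).symm)
    exact (smul_ne_zero ha (hv0 α)) this
  constructor
  · obtain ⟨f, h1, h2, h3, h4, h5, h6⟩ := hframe.exists_phase hσ hp0
    rw [hhalf] at h5 h6
    refine ⟨_, ⟨fun α => ?_, h1, h2, h3, h4, h5⟩, h6⟩
    rw [smul_smul]
    obtain ⟨ψ, hψ, hae, -⟩ := hmode α (f α * ((‖v α‖⁻¹ : ℝ) : ℂ))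
    exact ⟨ψ, hψ, hae⟩
  · intro u hu
    have := hframe.phase (u := u) hσ hp0 (fun α => ?_) hu.normalised hu.continuous hu.periodic
      hu.differentiable (by rw [hhalf]; exact hu.integrable)
    · rwa [hhalf] at this
    · obtain ⟨φ, hφ, hφu⟩ := hu.mode α
      obtain ⟨ψ, hψ, hψv, hψ0⟩ := hmode α 1
      obtain ⟨a, ha⟩ := OnBand.isNondegenerate hℓ hs h hω α ψ φ hψ hφ (hψ0 one_ne_zero)
      have hne : ((‖v α‖ : ℝ) : ℂ) ≠ 0 := by
        exact_mod_cast norm_ne_zero_iff.2 (hv0 α)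
      refine ⟨a * ‖v α‖, ?_⟩
      rw [smul_smul, mul_assoc, Complex.ofReal_inv, mul_inv_cancel₀ hne, mul_one]
      refine Lp.ext ?_
      rw [one_smul] at hψv
      filter_upwards [hφu, hψv, Lp.coeFn_smul a (v α)] with x h1 h2 h3
      rw [h1, h3, Pi.smul_apply, h2, ha]; rfl

@[fun_prop] theorem continuous_tB (c : DimerChain) (δ : ℝ) : Continuous (c.tB δ) := by
  unfold tB; fun_prop

@[fun_prop] theorem continuous_tC (c : DimerChain) (δ : ℝ) : Continuous (c.tC δ) := by
  unfold tC; fun_prop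

theorem differentiable_tA (c : DimerChain) (δ : ℝ) : Differentiable ℝ (c.tA δ) := by
  unfold tA entry; fun_prop

theorem differentiable_tD (c : DimerChain) (δ : ℝ) : Differentiable ℝ (c.tD δ) := by
  unfold tD entry; fun_prop

theorem differentiable_tC (c : DimerChain) (δ : ℝ) : Differentiable ℝ (c.tC δ) := by
  unfold tC; fun_prop

theorem differentiableAt_tB (c : DimerChain) (δ : ℝ) {ω : ℝ} (h0 : ω ≠ 0) :
    DifferentiableAt ℝ (c.tB δ) ω := by
  have s1 (y : ℝ) : DifferentiableAt ℝ (fun ω => sn (ω / c.v) y) ω :=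
    differentiableAt_sn (f := fun ω => ω / c.v) (by fun_prop) (div_ne_zero h0 c.v_pos.ne') y
  have s2 (y : ℝ) : DifferentiableAt ℝ (fun ω => sn (ω / c.vb) y) ω :=
    differentiableAt_sn (f := fun ω => ω / c.vb) (by fun_prop) (div_ne_zero h0 c.vb_pos.ne') y
  unfold tB
  have s3 := s1 (c.s₁ / 2 + c.s₂ / 2)
  have s4 := s1 (c.s₁ / 2)
  have s5 := s1 (c.s₂ / 2)
  have s6 := s2 c.ℓ₁
  fun_prop

/-- For `ω > 0` on the lower band `tA * tD < 1`, so `tB * tC < 0` by the determinant, and `tC` is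
negative. -/
theorem OnBand.b_pos (h : c.Window δ ε) {α ω : ℝ} (hω : c.OnBand δ ε 1 α ω) : 0 < c.tB δ ω := by
  obtain ⟨hm, h1, h2, h3⟩ := hω
  rw [one_mul] at h1 h2
  rcases hm.1.eq_or_lt with h0 | h0
  · rw [← h0]; exact h.b_zero
  · have m0 : (0 : ℝ) ∈ Set.Icc 0 ε := ⟨le_rfl, h.ε_pos.le⟩
    have ha := h.a_anti m0 hm h0
    have hd := h.d_anti m0 hm h0
    rw [h.a_zero] at ha
    rw [h.d_zero] at hd
    have hdet := c.det_transfer h.δ_pos ω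
    have hc := h.c_neg ω ⟨h0, hm.2⟩
    have : c.tA δ ω * c.tD δ ω < 1 := mul_lt_one_of_nonneg_of_lt_one_left h1 ha hd.le
    by_contra! hb
    nlinarith [mul_nonneg_of_nonpos_of_nonpos hb hc.le]

theorem OnBand.ne_zero_of_lower (h : c.Window δ ε) {α ω : ℝ} (hω : c.OnBand δ ε 1 α ω) :
    (c.s₂ < c.s₁ → c.tA δ ω ≠ 0) ∧ (c.s₁ < c.s₂ → c.tD δ ω ≠ 0) := by
  obtain ⟨hm, h1, h2, h3⟩ := hω
  rw [one_mul] at h1 h2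
  rcases hm.1.eq_or_lt with h0 | h0
  · rw [← h0, h.a_zero, h.d_zero]; simp
  · exact ⟨fun hs => (h2.trans_lt (h.d_lt_a hs ω ⟨h0, hm.2⟩)).ne',
      fun hs => (h1.trans_lt (h.a_lt_d hs ω ⟨h0, hm.2⟩)).ne'⟩

/-- The larger diagonal entry is at most zero, so the smaller one is strictly negative. Here `tC`
takes the place of `tB`, which vanishes on this band at `α = 0`. -/
theorem OnBand.ne_zero_of_upper (h : c.Window δ ε) {α ω : ℝ} (hω : c.OnBand δ ε (-1) α ω) :
    (c.s₂ < c.s₁ → c.tD δ ω ≠ 0) ∧ (c.s₁ < c.s₂ → c.tA δ ω ≠ 0) ∧ c.tC δ ω ≠ 0 := by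
  obtain ⟨hm, h1, h2, h3⟩ := hω
  have h0 : 0 < ω := by
    refine hm.1.lt_of_ne fun h0 => ?_
    rw [← h0, h.a_zero] at h1
    linarith
  have hm' : ω ∈ Set.Ioc 0 ε := ⟨h0, hm.2⟩
  exact ⟨fun hs => ((h.d_lt_a hs ω hm').trans_le (by linarith)).ne,
    fun hs => ((h.a_lt_d hs ω hm').trans_le (by linarith)).ne, (h.c_neg ω hm').ne⟩

/-- `(A, B)` is read off from one mode equation or the other, after scaling by a nonvanishing entry
if necessary. The choice must vanish nowhere; the entries are periodic, so its sign over a period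
comes only from `sin (αL/2)` and `cos (αL/2)`. -/
theorem zak_of_onBand (hℓ : c.ℓ₁ = c.ℓ₂) (hs : c.s₁ ≠ c.s₂) (h : c.Window δ ε)
    (hτ : τ = 1 ∨ τ = -1) (hσ : c.s₁ < c.s₂ ∧ σ = 1 ∨ c.s₂ < c.s₁ ∧ σ = -1) {ω : ℝ → ℝ}
    (hω : ∀ α, c.OnBand δ ε τ α (ω α)) :
    (∃ u : ℝ → Lp ℂ 2 (volume.restrict c.D), c.IsModeFamily δ ω u ∧
      c.zak u = (if σ = 1 then 0 else Real.pi : ℝ)) ∧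
    ∀ u : ℝ → Lp ℂ 2 (volume.restrict c.D), c.IsModeFamily δ ω u →
      ∃ n : ℤ, c.zak u = (if σ = 1 then 0 else Real.pi : ℝ) + 2 * Real.pi * n := by
  have cω := OnBand.continuous hτ h hω
  have ca : Continuous fun α => c.tA δ (ω α) := (c.continuous_tA δ).comp cω
  have cb : Continuous fun α => c.tB δ (ω α) := (c.continuous_tB δ).comp cω
  have cc : Continuous fun α => c.tC δ (ω α) := (c.continuous_tC δ).comp cω
  have cd : Continuous fun α => c.tD δ (ω α) := (c.continuous_tD δ).comp cω
  have hdiff : ∀ α, Real.sin (α * c.L) ≠ 0 → DifferentiableAt ℝ (fun α => c.tA δ (ω α)) α ∧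
      DifferentiableAt ℝ (fun α => c.tB δ (ω α)) α ∧
      DifferentiableAt ℝ (fun α => c.tC δ (ω α)) α ∧
      DifferentiableAt ℝ (fun α => c.tD δ (ω α)) α := by
    intro α hα
    rw [show α * c.L = 2 * (α * c.L / 2) by ring, Real.sin_two_mul] at hα
    have h2 := right_ne_zero_of_mul (left_ne_zero_of_mul hα)
    have dω := OnBand.differentiableAt hτ h hω h2 (right_ne_zero_of_mul hα)
    exact ⟨(c.differentiable_tA δ _).comp α dω,
      (c.differentiableAt_tB δ ((hω α).pos_of_sin_ne_zero h h2).ne').comp α dω,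
      (c.differentiable_tC δ _).comp α dω, (c.differentiable_tD δ _).comp α dω⟩
  have hωp : ∀ α, ω (α + 2 * Real.pi / c.L) = ω α :=
    fun α => (hω _).unique hτ h (hω α).add_period
  have hdet := fun α => c.det_transfer h.δ_pos (ω α)
  have hsq := fun α => Real.cos_sq_add_sin_sq (α * c.L / 2)
  have hmul := fun α => (hω α).2.2.2
  have hsc : ∀ α, Real.cos (α * c.L / 2) ≠ 0 ∨ Real.sin (α * c.L / 2) ≠ 0 := fun α => by
    by_contra! h0
    have := hsq α
    rw [h0.1, h0.2] at this
    norm_num at this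
  have key : ∀ α, Real.cos (α * c.L / 2) ^ 2 * (c.tB δ (ω α) * c.tC δ (ω α)) +
      Real.sin (α * c.L / 2) ^ 2 * (c.tA δ (ω α) * c.tD δ (ω α)) = 0 := fun α => by
    linear_combination c.tA δ (ω α) * c.tD δ (ω α) * hsq α - Real.cos (α * c.L / 2) ^ 2 * hdet α +
      hmul α
  have key' : ∀ α, c.tB δ (ω α) * c.tC δ (ω α) + Real.sin (α * c.L / 2) ^ 2 = 0 := fun α => by
    linear_combination hmul α - hdet α + hsq α
  have hcp : ∀ α, Real.cos ((α + 2 * Real.pi / c.L) * c.L / 2) = -Real.cos (α * c.L / 2) :=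
    fun α => by rw [half_period, Real.cos_add_pi]
  have hsp : ∀ α, Real.sin ((α + 2 * Real.pi / c.L) * c.L / 2) = -Real.sin (α * c.L / 2) :=
    fun α => by rw [half_period, Real.sin_add_pi]
  have hσ' : σ = 1 ∨ σ = -1 := hσ.imp And.right And.right
  rcases hτ with rfl | rfl <;> rcases hσ with ⟨hlt, rfl⟩ | ⟨hlt, rfl⟩
  -- Here `tD > 0` and `tB > 0`, so `A` never vanishes; both signs in `B` cancel and the frame is
  -- periodic.
  · refine zak_of_realMode hℓ hs h (.inl rfl) hσ' hω
      (A := fun α => c.tB δ (ω α) * c.tD δ (ω α))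
      (B := fun α => Real.sin (α * c.L / 2) * Real.cos (α * c.L / 2))
      (by fun_prop) (by fun_prop) (fun α hα => ?_) (fun α _ => by fun_prop) (fun α => ?_)
      (fun α => ⟨?_, ?_⟩) (fun α => ?_) (fun α => ?_)
    · obtain ⟨-, d2, -, d4⟩ := hdiff α hα
      fun_prop
    · exact .inl (mul_ne_zero ((hω α).b_pos h).ne' (((hω α).ne_zero_of_lower h).2 hlt))
    · linear_combination -c.tB δ (ω α) * Real.sin (α * c.L / 2) * hmul α
    · linear_combination Real.cos (α * c.L / 2) * c.tD δ (ω α) * key' α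
    · simp only [hωp]; ring
    · simp only [hcp, hsp]; ring
  -- Now `tA > 0`: `(A, B)` is `(cos, sin)` with positive weights, which is antiperiodic.
  · refine zak_of_realMode hℓ hs h (.inl rfl) hσ' hω
      (A := fun α => c.tB δ (ω α) * Real.cos (α * c.L / 2))
      (B := fun α => c.tA δ (ω α) * Real.sin (α * c.L / 2))
      (by fun_prop) (by fun_prop) (fun α hα => ?_) (fun α hα => ?_) (fun α => ?_)
      (fun α => ⟨?_, ?_⟩) (fun α => ?_) (fun α => ?_)
    · obtain ⟨-, d2, -, -⟩ := hdiff α hα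
      fun_prop
    · obtain ⟨d1, -, -, -⟩ := hdiff α hα
      fun_prop
    · exact (hsc α).imp (mul_ne_zero ((hω α).b_pos h).ne')
        (mul_ne_zero (((hω α).ne_zero_of_lower h).1 hlt))
    · ring
    · linear_combination key α
    · simp only [hωp, hcp]; ring
    · simp only [hωp, hsp]; ring
  -- On the upper band the roles are exchanged: `tA` and `tC` are nonzero, so `B` never vanishes.
  · refine zak_of_realMode hℓ hs h (.inr rfl) hσ' hω
      (A := fun α => Real.sin (α * c.L / 2) * Real.cos (α * c.L / 2))
      (B := fun α => -(c.tA δ (ω α) * c.tC δ (ω α)))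
      (by fun_prop) (by fun_prop) (fun α _ => by fun_prop) (fun α hα => ?_) (fun α => ?_)
      (fun α => ⟨?_, ?_⟩) (fun α => ?_) (fun α => ?_)
    · obtain ⟨d1, -, d3, -⟩ := hdiff α hα
      fun_prop
    · obtain ⟨-, e2, e3⟩ := (hω α).ne_zero_of_upper h
      exact .inr (neg_ne_zero.2 (mul_ne_zero (e2 hlt) e3))
    · linear_combination -c.tA δ (ω α) * Real.cos (α * c.L / 2) * key' α
    · linear_combination -c.tC δ (ω α) * Real.sin (α * c.L / 2) * hmul α
    · simp only [hcp, hsp]; ring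
    · simp only [hωp]; ring
  -- With `tD` and `tC` nonzero, the weighted `(sin, cos)` is again nonvanishing and antiperiodic.
  · refine zak_of_realMode hℓ hs h (.inr rfl) hσ' hω
      (A := fun α => c.tD δ (ω α) * Real.sin (α * c.L / 2))
      (B := fun α => -(c.tC δ (ω α) * Real.cos (α * c.L / 2)))
      (by fun_prop) (by fun_prop) (fun α hα => ?_) (fun α hα => ?_) (fun α => ?_)
      (fun α => ⟨?_, ?_⟩) (fun α => ?_) (fun α => ?_)
    · obtain ⟨-, -, -, d4⟩ := hdiff α hα
      fun_prop
    · obtain ⟨-, -, d3, -⟩ := hdiff α hα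
      fun_prop
    · obtain ⟨e1, -, e3⟩ := (hω α).ne_zero_of_upper h
      exact (hsc α).symm.imp (mul_ne_zero (e1 hlt)) fun e => neg_ne_zero.2 (mul_ne_zero e3 e)
    · linear_combination -key α
    · ring
    · simp only [hωp, hsp]; ring
    · simp only [hωp, hcp]; ring

end

end DimerChain

theorem mainTheorem3 (c : DimerChain) (hℓ : c.ℓ₁ = c.ℓ₂) (hs : c.s₁ ≠ c.s₂) :
    -- for small contrast there are exactly two subwavelength bands
    (∃ ω₁ ω₂ : ℝ → ℝ → ℝ, c.IsSubwavelengthBand ω₁ ∧ c.IsSubwavelengthBand ω₂ ∧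
      (∀ᶠ δ in 𝓝[>] (0 : ℝ), ∀ α, ω₁ δ α < ω₂ δ α) ∧
      ∀ ω : ℝ → ℝ → ℝ, c.IsSubwavelengthBand ω →
        ∀ᶠ δ in 𝓝[>] (0 : ℝ), ω δ = ω₁ δ ∨ ω δ = ω₂ δ) ∧
    -- each of them is non-degenerate and has the stated Zak phase, which is defined modulo 2π
    ∀ ω : ℝ → ℝ → ℝ, c.IsSubwavelengthBand ω →
      ∀ᶠ δ in 𝓝[>] (0 : ℝ),
        c.IsNondegenerate δ (ω δ) ∧
        (∃ u : ℝ → Lp ℂ 2 (volume.restrict c.D), c.IsModeFamily δ (ω δ) u ∧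
          (c.s₂ < c.s₁ → c.zak u = Real.pi) ∧ (c.s₁ < c.s₂ → c.zak u = 0)) ∧
        ∀ u : ℝ → Lp ℂ 2 (volume.restrict c.D), c.IsModeFamily δ (ω δ) u →
          ∃ n : ℤ, (c.s₂ < c.s₁ → c.zak u = Real.pi + 2 * Real.pi * n) ∧
            (c.s₁ < c.s₂ → c.zak u = 2 * Real.pi * n) := by
  obtain ⟨ε, hε, hw⟩ := c.exists_window
  have hwε := hw ε ⟨hε, le_rfl⟩
  refine ⟨⟨c.band ε 1, c.band ε (-1), DimerChain.isSubwavelengthBand_band hℓ (.inl rfl) hε hw,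
    DimerChain.isSubwavelengthBand_band hℓ (.inr rfl) hε hw, ?_, fun ω hω => ?_⟩, fun ω hω => ?_⟩
  · filter_upwards [hwε] with δ h α
    exact (DimerChain.onBand_band (.inl rfl) h α).lt hs h (DimerChain.onBand_band (.inr rfl) h α)
  · filter_upwards [hω.eventually_onBand hℓ hs hε hwε] with δ ⟨h, hor⟩
    exact hor.imp
      (fun hb => funext fun α => (hb α).unique (.inl rfl) h
        (DimerChain.onBand_band (.inl rfl) h α))
      (fun hb => funext fun α => (hb α).unique (.inr rfl) h
        (DimerChain.onBand_band (.inr rfl) h α))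
  · filter_upwards [hω.eventually_onBand hℓ hs hε hwε] with δ ⟨h, hor⟩
    obtain ⟨τ, hτ, hb⟩ : ∃ τ : ℝ, (τ = 1 ∨ τ = -1) ∧ ∀ α, c.OnBand δ ε τ α (ω δ α) :=
      hor.elim (fun hb => ⟨1, .inl rfl, hb⟩) fun hb => ⟨-1, .inr rfl, hb⟩
    refine ⟨DimerChain.OnBand.isNondegenerate hℓ hs h hb, ?_⟩
    rcases lt_or_gt_of_ne hs with hlt | hlt
    · obtain ⟨⟨u, hu, hz⟩, hall⟩ := DimerChain.zak_of_onBand hℓ hs h hτ (.inl ⟨hlt, rfl⟩) hb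
      refine ⟨⟨u, hu, fun h' => absurd h' hlt.not_gt, fun _ => by simpa using hz⟩, fun u hu => ?_⟩
      obtain ⟨n, hn⟩ := hall u hu
      exact ⟨n, fun h' => absurd h' hlt.not_gt, fun _ => by simpa using hn⟩
    · obtain ⟨⟨u, hu, hz⟩, hall⟩ := DimerChain.zak_of_onBand hℓ hs h hτ (.inr ⟨hlt, rfl⟩) hb
      rw [if_neg (by norm_num)] at hz
      refine ⟨⟨u, hu, fun _ => hz, fun h' => absurd h' hlt.not_gt⟩, fun u hu => ?_⟩
      obtain ⟨n, hn⟩ := hall u hu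
      rw [if_neg (by norm_num)] at hn
      exact ⟨n, fun _ => hn, fun h' => absurd h' hlt.not_gt⟩
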